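/- **Theorem (C\*-case of the Main Theorem).** Let $\Gamma$ be a discrete group with the approximation property (AP) of Haagerup and Kraus, that is, there is a net of finitely supported functions on $\Gamma$ converging to the constant function $1$ in the weak\* topology $\sigma(M_0A(\Gamma),Q(\Gamma))$, where $M_0A(\Gamma)$ is the space of completely bounded Fourier multipliers of $\Gamma$ and its predual $Q(\Gamma)$ is the completion of $\ell^1(\Gamma)$ for the norm $\|f\|_Q=\sup\{|\sum_s f(s)\varphi(s)| : \|\varphi\|_{M_0A(\Gamma)}\le 1\}$. Let $\Gamma$ act freely by homeomorphisms on locally compact Hausdorff spaces $X$ and $Y$, and let $\pi\colon Y\to X$ be a proper factor map, i.e. a $\Gamma$-equivariant quotient map such that preimages of compact sets are compact. Regard $C_0(X)$ as a $\Gamma$-C\*-subalgebra of $C_0(Y)$ via $f\mapsto f\circ\pi$. An intermediate extension of $\pi$ consists of an action of $\Gamma$ by homeomorphisms on a locally compact Hausdorff space $Z$ and equivariant quotient maps $p\colon Y\to Z$, $q\colon Z\to X$ with $q\circ p=\pi$; then $p$ is automatically proper, and $C_0(Z)$ is regarded as a $\Gamma$-C\*-subalgebra of $C_0(Y)$ via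 $f\mapsto f\circ p$, so that $C_0(X)\subseteq C_0(Z)\subseteq C_0(Y)$. Two intermediate extensions $(Z,p,q)$, $(Z',p',q')$ are identified if there is a $\Gamma$-equivariant homeomorphism $h\colon Z\to Z'$ with $h\circ p=p'$ and $q=q'\circ h$. By Gelfand duality, $Z\mapsto C_0(Z)$ is a bijection from the set of classes of intermediate extensions onto the set of $\Gamma$-invariant C\*-subalgebras of $C_0(Y)$ containing $C_0(X)$, and the former set carries the lattice structure induced by this bijection. Lattices of C\*-subalgebras carry the operations $C\vee D=C^*(C,D)$ (the C\*-subalgebra generated by $C$ and $D$) and $C\wedge D=C\cap D$. Then the map $$C_0(Z)\longmapsto C_0(Z)\rtimes_r\Gamma$$ is well defined on classes and is a lattice isomorphism from the lattice of intermediate extensions $Z$ of $\pi$ onto the lattice of all C\*-algebras $A$ with $C_0(X)\rtimes_r\Gamma\subseteq A\subseteq C_0(Y)\rtimes_r\Gamma$. Here $\rtimes_r$ denotes the reduced crossed product. -/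

import Mathlib

namespace CrossedExt

open Topology Filter
open scoped ENNReal ZeroAtInfty

noncomputable section

/-! ### Operators on `ℓ²(Γ, H)` -/

/-- The Hilbert space `ℓ²(ι, H) = ℓ²(ι) ⊗ H`. -/
abbrev L2 (ι H : Type*) [NormedAddCommGroup H] : Type _ := lp (fun _ : ι => H) 2

/-- The left translation `λ_s ⊗ 1` on `ℓ²(Γ, H)`: `(λ_s ξ)(t) = ξ (s⁻¹ t)`. -/
def translation {Γ H : Type*} [Group Γ] [NormedAddCommGroup H] [NormedSpace ℂ H] (s : Γ) :
    L2 Γ H →L[ℂ] L2 Γ H :=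
  LinearMap.mkContinuous
    { toFun := fun ξ => ⟨fun t => ξ (s⁻¹ * t), memℓp_gen (by
        have h := (memℓp_gen_iff (p := 2) (by simp)).1 (lp.memℓp ξ)
        exact (Equiv.mulLeft s⁻¹).summable_iff.2 h)⟩
      map_add' := fun _ _ => rfl
      map_smul' := fun _ _ => rfl } 1 (fun ξ => by
    rw [one_mul]
    refine le_of_eq ?_
    have h2 : (0 : ℝ) < (2 : ℝ≥0∞).toReal := by simp
    refine (Real.rpow_left_inj (norm_nonneg _) (norm_nonneg _) h2.ne').1 ?_
    rw [lp.norm_rpow_eq_tsum h2, lp.norm_rpow_eq_tsum h2]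
    exact (Equiv.mulLeft s⁻¹).tsum_eq (fun t => ‖ξ t‖ ^ (2 : ℝ≥0∞).toReal))

/-! ### The approximation property of Haagerup and Kraus -/

/-- The operator `T ⊗ λ_s` on `ℂⁿ ⊗ ℓ²(Γ) = ℓ²(Γ, ℂⁿ)`. -/
def tensorTranslation {Γ : Type*} [Group Γ] {n : ℕ}
    (T : EuclideanSpace ℂ (Fin n) →L[ℂ] EuclideanSpace ℂ (Fin n)) (s : Γ) :
    L2 Γ (EuclideanSpace ℂ (Fin n)) →L[ℂ] L2 Γ (EuclideanSpace ℂ (Fin n)) :=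
  (lp.mapCLM 2 (fun _ : Γ => T) (norm_nonneg T) (fun _ => le_rfl)) ∘L translation s

/-- The Fourier multiplier `λ_s ↦ φ(s) λ_s` of the reduced group C*-algebra of `Γ` is completely
bounded with completely bounded norm at most `C`: for every `n`, its amplification to
`M_n(ℂ) ⊗ ℂ[Γ]`, acting on `ℂⁿ ⊗ ℓ²(Γ)`, has norm at most `C`. -/
def IsCBMultiplierWith {Γ : Type*} [Group Γ] (φ : Γ → ℂ) (C : ℝ) : Prop :=
  ∀ (n : ℕ) (b : Γ →₀ (EuclideanSpace ℂ (Fin n) →L[ℂ] EuclideanSpace ℂ (Fin n))),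
    ‖b.sum fun s T => φ s • tensorTranslation T s‖ ≤ C * ‖b.sum fun s T => tensorTranslation T s‖

/-- The space `M₀A(Γ)` of completely bounded Fourier multipliers (Herz–Schur multipliers). -/
def cbMultipliers (Γ : Type*) [Group Γ] : Submodule ℂ (Γ → ℂ) where
  carrier := {φ | ∃ C, IsCBMultiplierWith φ C}
  zero_mem' := ⟨0, fun n b => by simp [Finsupp.sum]⟩
  add_mem' := by
    rintro φ ψ ⟨C, hC⟩ ⟨D, hD⟩
    refine ⟨C + D, fun n b => ?_⟩
    have : (b.sum fun s T => (φ + ψ) s • tensorTranslation T s) =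
        (b.sum fun s T => φ s • tensorTranslation T s) +
          b.sum fun s T => ψ s • tensorTranslation T s := by
      simp [Finsupp.sum, add_smul, Finset.sum_add_distrib]
    rw [this, add_mul]
    exact (norm_add_le _ _).trans (add_le_add (hC n b) (hD n b))
  smul_mem' := by
    rintro c φ ⟨C, hC⟩
    refine ⟨‖c‖ * C, fun n b => ?_⟩
    have : (b.sum fun s T => (c • φ) s • tensorTranslation T s) =
        c • (b.sum fun s T => φ s • tensorTranslation T s) := by
      simp [Finsupp.sum, mul_smul, Finset.smul_sum]
    rw [this, norm_smul, mul_assoc]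
    exact mul_le_mul_of_nonneg_left (hC n b) (norm_nonneg c)

/-- The constant function `1`, as a completely bounded multiplier. -/
def cbOne (Γ : Type*) [Group Γ] : cbMultipliers Γ :=
  ⟨fun _ => 1, 1, fun n b => by simp⟩

/-- The elements of the predual `Q(Γ)` of `M₀A(Γ)`, viewed as linear functionals on `M₀A(Γ)`.
By definition `Q(Γ)` is the completion of `ℓ¹(Γ)` for the norm
`‖f‖ = sup {|∑ f(s) φ(s)| : ‖φ‖_{M₀A(Γ)} ≤ 1}`, that is, the norm closure of `ℓ¹(Γ)` in the dual
of `M₀A(Γ)`. -/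
def IsPredualFunctional {Γ : Type*} [Group Γ] (q : cbMultipliers Γ →ₗ[ℂ] ℂ) : Prop :=
  ∀ ε > (0 : ℝ), ∃ f : Γ → ℂ, Summable (fun s => ‖f s‖) ∧
    ∀ (φ : cbMultipliers Γ) (C : ℝ), IsCBMultiplierWith (φ : Γ → ℂ) C →
      ‖q φ - ∑' s, f s * (φ : Γ → ℂ) s‖ ≤ ε * C

/-- The approximation property (AP) of Haagerup and Kraus for a discrete group: there is a net
(here: a proper filter) of finitely supported functions which converges to the constant
function `1` in the weak* topology `σ(M₀A(Γ), Q(Γ))`. -/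
def HasAP (Γ : Type*) [Group Γ] : Prop :=
  ∃ l : Filter (cbMultipliers Γ), l.NeBot ∧
    (∀ᶠ φ in l, (Function.support φ.1).Finite) ∧
    ∀ q : cbMultipliers Γ →ₗ[ℂ] ℂ, IsPredualFunctional q → Tendsto q l (𝓝 (q (cbOne Γ)))

/-! ### The lattice of C*-subalgebras -/

/-- The C*-subalgebras of a C*-algebra `D`: the norm closed (not necessarily unital)
*-subalgebras. -/
def CStarSubalgebra (D : Type*) [NonUnitalCStarAlgebra D] : Type _ :=
  {C : NonUnitalStarSubalgebra ℂ D // IsClosed (C : Set D)}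

namespace CStarSubalgebra

variable {D : Type*} [NonUnitalCStarAlgebra D]

instance : PartialOrder (CStarSubalgebra D) :=
  inferInstanceAs (PartialOrder {C : NonUnitalStarSubalgebra ℂ D // IsClosed (C : Set D)})

/-- The C*-subalgebra generated by a set. -/
def generate (S : Set D) : CStarSubalgebra D :=
  ⟨(NonUnitalStarAlgebra.adjoin ℂ S).topologicalClosure,
    NonUnitalStarSubalgebra.isClosed_topologicalClosure _⟩

theorem generate_le {S : Set D} {C : CStarSubalgebra D} : generate S ≤ C ↔ S ⊆ (C.1 : Set D) :=
  ⟨fun h => ((NonUnitalStarAlgebra.subset_adjoin ℂ S).trans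
      (NonUnitalStarSubalgebra.le_topologicalClosure _)).trans h,
    fun h => NonUnitalStarSubalgebra.topologicalClosure_minimal _
      (NonUnitalStarAlgebra.adjoin_le h) C.2⟩

/-- `A ⊔ B` is the C*-subalgebra generated by `A` and `B`, and `A ⊓ B` is the intersection. -/
instance : Lattice (CStarSubalgebra D) where
  sup A B := generate ((A.1 : Set D) ∪ (B.1 : Set D))
  le_sup_left _ _ := (Set.subset_union_left).trans (generate_le.1 le_rfl)
  le_sup_right _ _ := (Set.subset_union_right).trans (generate_le.1 le_rfl)
  sup_le _ _ _ h₁ h₂ := generate_le.2 (Set.union_subset h₁ h₂)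
  inf A B := ⟨A.1 ⊓ B.1, by
    rw [NonUnitalStarAlgebra.coe_inf]
    exact A.2.inter B.2⟩
  inf_le_left _ _ := fun _ hx => (NonUnitalStarAlgebra.mem_inf.1 hx).1
  inf_le_right _ _ := fun _ hx => (NonUnitalStarAlgebra.mem_inf.1 hx).2
  le_inf _ _ _ h₁ h₂ := fun _ hx => NonUnitalStarAlgebra.mem_inf.2 ⟨h₁ hx, h₂ hx⟩

end CStarSubalgebra

/-! ### Reduced crossed products -/

section CrossedProduct

variable {Γ A H : Type*} [Group Γ] [NonUnitalCStarAlgebra A]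
  [NormedAddCommGroup H] [InnerProductSpace ℂ H] [CompleteSpace H]

/-- For an action `α` of `Γ` on a C*-algebra `A` and a representation `ρ` of `A` on `H`, the
representation of `A` on `ℓ²(Γ, H)` given by `(a ξ)(t) = ρ(α_{t⁻¹}(a)) ξ(t)`. -/
def regularRep (α : Γ → A →⋆ₙₐ[ℂ] A) (ρ : A →⋆ₙₐ[ℂ] (H →L[ℂ] H)) (a : A) :
    L2 Γ H →L[ℂ] L2 Γ H :=
  lp.mapCLM 2 (fun t : Γ => ρ (α t⁻¹ a)) (norm_nonneg a) fun t =>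
    (NonUnitalStarAlgHom.norm_apply_le ρ _).trans (NonUnitalStarAlgHom.norm_apply_le (α t⁻¹) a)

/-- The reduced crossed product `A ⋊_r Γ`, realised on `ℓ²(Γ, H)` through a faithful
representation `ρ` of `A` on a Hilbert space `H`: the C*-algebra generated by the operators
`a u_s`, `a ∈ A`, `s ∈ Γ`, of the regular representation induced by `ρ`. -/
def reducedCrossedProduct (α : Γ → A →⋆ₙₐ[ℂ] A) (ρ : A →⋆ₙₐ[ℂ] (H →L[ℂ] H)) :
    CStarSubalgebra (L2 Γ H →L[ℂ] L2 Γ H) :=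
  CStarSubalgebra.generate (Set.range fun x : A × Γ => regularRep α ρ x.1 * translation x.2)

end CrossedProduct

/-! ### Functions vanishing at infinity -/

section Functions

/-- Composition with a continuous proper map, as a *-homomorphism `C₀(Z) → C₀(Y)`. -/
def pullback {Y Z : Type*} [TopologicalSpace Y] [TopologicalSpace Z] (g : CocompactMap Y Z) :
    C₀(Z, ℂ) →⋆ₙₐ[ℂ] C₀(Y, ℂ) :=
  { ZeroAtInftyContinuousMap.compNonUnitalAlgHom g with
    map_star' := fun _ => rfl }

/-- The action of `Γ` on `C₀(Z)` induced by an action on `Z`: `α_s(f) = f ∘ α_s⁻¹`. -/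
def functionAction (Γ Z : Type*) [Group Γ] [TopologicalSpace Z] [MulAction Γ Z]
    [ContinuousConstSMul Γ Z] (s : Γ) : C₀(Z, ℂ) →⋆ₙₐ[ℂ] C₀(Z, ℂ) :=
  pullback
    { toFun := fun z => s⁻¹ • z
      continuous_toFun := continuous_const_smul s⁻¹
      cocompact_tendsto' := (Homeomorph.smul s⁻¹).isClosedEmbedding.tendsto_cocompact }

/-- The faithful representation of `C₀(Y)` on `ℓ²(Y)` by multiplication. -/
def multiplicationRep (Y : Type*) [TopologicalSpace Y] :
    C₀(Y, ℂ) →⋆ₙₐ[ℂ] (L2 Y ℂ →L[ℂ] L2 Y ℂ) where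
  toFun f := lp.mapCLM 2 (fun y : Y => ContinuousLinearMap.mul ℂ ℂ (f y)) (norm_nonneg f)
    fun y => by
      rw [ContinuousLinearMap.opNorm_mul_apply]
      exact f.toBCF.norm_coe_le_norm y
  map_smul' c f := by
    ext ξ y
    simp [mul_assoc]
  map_zero' := by
    ext ξ y
    simp
  map_add' f g := by
    ext ξ y
    simp
  map_mul' f g := by
    ext ξ y
    simp [mul_assoc]
  map_star' f := by
    rw [ContinuousLinearMap.star_eq_adjoint, ContinuousLinearMap.eq_adjoint_iff]
    intro ξ η
    rw [lp.inner_eq_tsum, lp.inner_eq_tsum]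
    refine tsum_congr fun y => ?_
    simp
    ring

end Functions

/-! ### Extensions of topological dynamical systems -/

/-- A factor map: an equivariant quotient map. -/
structure IsFactorMap (Γ : Type*) {Y X : Type*} [Group Γ] [TopologicalSpace Y] [TopologicalSpace X]
    [MulAction Γ Y] [MulAction Γ X] (π : Y → X) : Prop where
  isQuotientMap : IsQuotientMap π
  map_smul : ∀ (s : Γ) (y : Y), π (s • y) = s • π y

/-- A proper factor map: a factor map such that the preimage of any compact set is compact. -/
structure ProperFactorMap (Γ Y X : Type*) [Group Γ] [TopologicalSpace Y] [TopologicalSpace X]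
    [MulAction Γ Y] [MulAction Γ X] where
  toFun : Y → X
  isFactorMap : IsFactorMap Γ toFun
  isCompact_preimage : ∀ K : Set X, IsCompact K → IsCompact (toFun ⁻¹' K)

section Extensions

universe u v w

variable {Γ : Type u} {Y : Type v} {X : Type w} [Group Γ]
  [TopologicalSpace Y] [MulAction Γ Y]
  [TopologicalSpace X] [MulAction Γ X]

/-- A proper factor map, as a continuous proper map. -/
def ProperFactorMap.toCocompactMap [T2Space X] (π : ProperFactorMap Γ Y X) : CocompactMap Y X where
  toFun := π.toFun
  continuous_toFun := π.isFactorMap.isQuotientMap.continuous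
  cocompact_tendsto' := by
    refine (hasBasis_cocompact.tendsto_right_iff).2 fun K hK => ?_
    exact (π.isCompact_preimage K hK).compl_mem_cocompact

/-- An intermediate extension `Y → Z → X` of an extension `π : Y → X`. -/
structure IntermediateExtension (π : ProperFactorMap Γ Y X) where
  Z : Type v
  [topologicalSpace : TopologicalSpace Z]
  [t2Space : T2Space Z]
  [locallyCompactSpace : LocallyCompactSpace Z]
  [mulAction : MulAction Γ Z]
  [continuousConstSMul : ContinuousConstSMul Γ Z]
  p : Y → Z
  q : Z → X
  isFactorMap_p : IsFactorMap Γ p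
  isFactorMap_q : IsFactorMap Γ q
  comp_eq : ∀ y, q (p y) = π.toFun y

attribute [instance] IntermediateExtension.topologicalSpace IntermediateExtension.t2Space
  IntermediateExtension.locallyCompactSpace IntermediateExtension.mulAction
  IntermediateExtension.continuousConstSMul

namespace IntermediateExtension

variable {π : ProperFactorMap Γ Y X}

/-- Two intermediate extensions are identified if there is a `Γ`-homeomorphism between them that
is compatible with the factor maps. -/
def Equivalent (E F : IntermediateExtension π) : Prop :=
  ∃ h : E.Z ≃ₜ F.Z, (∀ (s : Γ) (z : E.Z), h (s • z) = s • h z) ∧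
    (∀ y, h (E.p y) = F.p y) ∧ ∀ z, E.q z = F.q (h z)

instance setoid (π : ProperFactorMap Γ Y X) : Setoid (IntermediateExtension π) where
  r := Equivalent
  iseqv :=
    { refl := fun E => ⟨Homeomorph.refl _, fun _ _ => rfl, fun _ => rfl, fun _ => rfl⟩
      symm := by
        rintro E F ⟨h, h₁, h₂, h₃⟩
        refine ⟨h.symm, fun s z => ?_, fun y => ?_, fun z => ?_⟩
        · rw [Homeomorph.symm_apply_eq, h₁, Homeomorph.apply_symm_apply]
        · rw [Homeomorph.symm_apply_eq, h₂]
        · rw [h₃, Homeomorph.apply_symm_apply]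
      trans := by
        rintro E F G ⟨h, h₁, h₂, h₃⟩ ⟨k, k₁, k₂, k₃⟩
        refine ⟨h.trans k, fun s z => ?_, fun y => ?_, fun z => ?_⟩
        · simp [h₁, k₁]
        · simp [h₂, k₂]
        · simp [h₃, k₃] }

/-- The factor map `Y → Z` of an intermediate extension of a proper extension is proper. -/
def toCocompactMap (E : IntermediateExtension π) : CocompactMap Y E.Z where
  toFun := E.p
  continuous_toFun := E.isFactorMap_p.isQuotientMap.continuous
  cocompact_tendsto' := by
    refine (hasBasis_cocompact.tendsto_right_iff).2 fun K hK => ?_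
    refine IsCompact.compl_mem_cocompact (s := E.p ⁻¹' K) ?_
    refine (π.isCompact_preimage _
      (hK.image E.isFactorMap_q.isQuotientMap.continuous)).of_isClosed_subset
      (hK.isClosed.preimage E.isFactorMap_p.isQuotientMap.continuous) fun y hy => ?_
    exact ⟨E.p y, hy, E.comp_eq y⟩

end IntermediateExtension

theorem isClosed_range_pullback {Y Z : Type*} [TopologicalSpace Y] [TopologicalSpace Z]
    (g : CocompactMap Y Z) (hg : Function.Surjective g) :
    IsClosed (Set.range (pullback g)) := by
  refine (Isometry.isClosedEmbedding
    (AddMonoidHomClass.isometry_of_norm (pullback g) fun f => ?_)).isClosed_range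
  refine le_antisymm (NonUnitalStarAlgHom.norm_apply_le (pullback g) f) ?_
  rw [← ZeroAtInftyContinuousMap.norm_toBCF_eq_norm]
  refine (BoundedContinuousFunction.norm_le (norm_nonneg _)).2 fun z => ?_
  obtain ⟨y, rfl⟩ := hg z
  exact (pullback g f).toBCF.norm_coe_le_norm y

/-- The C*-subalgebra `C₀(Z) ⊆ C₀(Y)` of functions that factor through a proper surjection
`Y → Z`. -/
def functionAlgebra {Y Z : Type*} [TopologicalSpace Y] [TopologicalSpace Z]
    (g : CocompactMap Y Z) (hg : Function.Surjective g) : CStarSubalgebra C₀(Y, ℂ) :=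
  ⟨NonUnitalStarAlgHom.range (pullback g), isClosed_range_pullback g hg⟩

/-- The intermediate `Γ`-C*-algebras of `C₀(X) ⊆ C₀(Y)`: the `Γ`-invariant C*-subalgebras
of `C₀(Y)` that contain `C₀(X)`. They form a sublattice of the lattice of C*-subalgebras. -/
def intermediateAlgebras [T2Space X] [ContinuousConstSMul Γ Y] (π : ProperFactorMap Γ Y X) :
    Sublattice (CStarSubalgebra C₀(Y, ℂ)) where
  carrier := {A | functionAlgebra π.toCocompactMap π.isFactorMap.isQuotientMap.surjective ≤ A ∧
    ∀ (s : Γ), ∀ a ∈ A.1, functionAction Γ Y s a ∈ A.1}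
  supClosed' := by
    rintro A ⟨hA, hA'⟩ B ⟨hB, hB'⟩
    refine ⟨hA.trans le_sup_left, fun s => ?_⟩
    have hc : Continuous (functionAction Γ Y s) :=
      AddMonoidHomClass.continuous_of_bound _ 1 fun a => by
        simpa using NonUnitalStarAlgHom.norm_apply_le (functionAction Γ Y s) a
    let C : CStarSubalgebra C₀(Y, ℂ) :=
      ⟨(A ⊔ B).1.comap (functionAction Γ Y s), (A ⊔ B).2.preimage hc⟩
    have : A ⊔ B ≤ C := sup_le (fun a ha => le_sup_left (a := A) (b := B) (hA' s a ha))
      (fun a ha => le_sup_right (a := A) (b := B) (hB' s a ha))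
    exact fun a ha => this ha
  infClosed' := by
    rintro A ⟨hA, hA'⟩ B ⟨hB, hB'⟩
    exact ⟨le_inf hA hB, fun s a ha => ⟨hA' s a ha.1, hB' s a ha.2⟩⟩

/-- The intermediate extensions of `π`, up to equivalence. -/
def ExtensionClass (π : ProperFactorMap Γ Y X) : Type (max u (v + 1) w) :=
  Quotient (IntermediateExtension.setoid π)

variable [T2Space X] [ContinuousConstSMul Γ Y]

namespace IntermediateExtension

/-- The intermediate `Γ`-C*-algebra `C₀(X) ⊆ C₀(Z) ⊆ C₀(Y)` of an intermediate extension. -/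
def algebra {π : ProperFactorMap Γ Y X} (E : IntermediateExtension π) : intermediateAlgebras π :=
  ⟨functionAlgebra E.toCocompactMap E.isFactorMap_p.isQuotientMap.surjective, by
    constructor
    · rintro _ ⟨f, rfl⟩
      let q : CocompactMap E.Z X :=
        { toFun := E.q
          continuous_toFun := E.isFactorMap_q.isQuotientMap.continuous
          cocompact_tendsto' := by
            refine (hasBasis_cocompact.tendsto_right_iff).2 fun K hK => ?_
            refine IsCompact.compl_mem_cocompact (s := E.q ⁻¹' K) ?_
            have : E.q ⁻¹' K = E.p '' (π.toFun ⁻¹' K) := by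
              ext z
              obtain ⟨y, rfl⟩ := E.isFactorMap_p.isQuotientMap.surjective z
              constructor
              · exact fun h => ⟨y, by simpa [E.comp_eq] using h, rfl⟩
              · rintro ⟨y', h', e⟩
                rw [← e]
                simpa [E.comp_eq] using h'
            rw [this]
            exact (π.isCompact_preimage K hK).image E.isFactorMap_p.isQuotientMap.continuous }
      refine ⟨pullback q f, ?_⟩
      ext y
      exact congrArg f (E.comp_eq y)
    · rintro s _ ⟨f, rfl⟩
      refine ⟨functionAction Γ E.Z s f, ?_⟩
      ext y
      exact congrArg f (E.isFactorMap_p.map_smul s⁻¹ y).symm⟩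

theorem mem_algebra {π : ProperFactorMap Γ Y X} {E : IntermediateExtension π} {a : C₀(Y, ℂ)} :
    a ∈ E.algebra.1.1 ↔ ∃ f : C₀(E.Z, ℂ), ∀ y, f (E.p y) = a y := by
  constructor
  · rintro ⟨f, rfl⟩
    exact ⟨f, fun _ => rfl⟩
  · rintro ⟨f, hf⟩
    exact ⟨f, ZeroAtInftyContinuousMap.ext hf⟩

theorem algebra_congr {π : ProperFactorMap Γ Y X} {E F : IntermediateExtension π}
    (h : E.Equivalent F) : E.algebra = F.algebra := by
  have key : ∀ E F : IntermediateExtension π, E.Equivalent F → E.algebra ≤ F.algebra := by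
    rintro E F ⟨h, -, h₂, -⟩ a ha
    obtain ⟨f, hf⟩ := mem_algebra.1 ha
    refine mem_algebra.2 ⟨pullback
      { toFun := h.symm
        continuous_toFun := h.symm.continuous
        cocompact_tendsto' := h.symm.isClosedEmbedding.tendsto_cocompact } f, fun y => ?_⟩
    rw [← hf y, ← h₂ y]
    exact congrArg f (h.symm_apply_apply _)
  exact le_antisymm (key E F h) (key F E ((IntermediateExtension.setoid π).symm h))

/-- Points of a locally compact Hausdorff space are separated by `C₀`. -/
theorem exists_zeroAtInfty_ne {Z : Type*} [TopologicalSpace Z] [T2Space Z] [LocallyCompactSpace Z]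
    {z w : Z} (h : z ≠ w) : ∃ f : C₀(Z, ℂ), f z = 1 ∧ f w = 0 := by
  obtain ⟨f, hf₁, hf₀, hfc, -⟩ := exists_continuous_one_zero_of_isCompact
    (isCompact_singleton (x := z)) (isClosed_singleton (x := w)) (by simpa using h)
  refine ⟨⟨⟨fun x => (f x : ℂ), by fun_prop⟩, ?_⟩, ?_, ?_⟩
  · have := (hfc.comp_left (g := fun r : ℝ => (r : ℂ)) (by simp))
    exact this.is_zero_at_infty
  · have := hf₁ (Set.mem_singleton z)
    simpa using congrArg (fun r : ℝ => (r : ℂ)) this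
  · have := hf₀ (Set.mem_singleton w)
    simpa using congrArg (fun r : ℝ => (r : ℂ)) this

theorem exists_map_of_le {π : ProperFactorMap Γ Y X} {E F : IntermediateExtension π}
    (h : E.algebra ≤ F.algebra) : ∃ r : F.Z → E.Z, Continuous r ∧ ∀ y, r (F.p y) = E.p y := by
  have key : ∀ y y', F.p y = F.p y' → E.p y = E.p y' := by
    intro y y' e
    by_contra hne
    obtain ⟨f, h1, h0⟩ := exists_zeroAtInfty_ne hne
    have hm : pullback E.toCocompactMap f ∈ E.algebra.1.1 := mem_algebra.2 ⟨f, fun _ => rfl⟩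
    obtain ⟨g, hg⟩ := mem_algebra.1 (h hm)
    have h2 : f (E.p y) = f (E.p y') := by
      have e1 := hg y
      have e2 := hg y'
      rw [e] at e1
      exact e1.symm.trans e2
    rw [h1, h0] at h2
    exact one_ne_zero h2
  have hs := F.isFactorMap_p.isQuotientMap.surjective
  have hr : ∀ y, E.p (Function.surjInv hs (F.p y)) = E.p y := fun y =>
    key _ _ (Function.surjInv_eq hs _)
  refine ⟨fun z => E.p (Function.surjInv hs z), ?_, hr⟩
  rw [F.isFactorMap_p.isQuotientMap.continuous_iff]
  have : (fun z => E.p (Function.surjInv hs z)) ∘ F.p = E.p := funext hr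
  rw [this]
  exact E.isFactorMap_p.isQuotientMap.continuous

theorem equivalent_of_algebra_eq {π : ProperFactorMap Γ Y X} {E F : IntermediateExtension π}
    (h : E.algebra = F.algebra) : E.Equivalent F := by
  obtain ⟨r, hr, hr'⟩ := exists_map_of_le h.le
  obtain ⟨k, hk, hk'⟩ := exists_map_of_le h.ge
  have hE := E.isFactorMap_p.isQuotientMap.surjective
  have hF := F.isFactorMap_p.isQuotientMap.surjective
  refine ⟨⟨⟨k, r, fun z => ?_, fun z => ?_⟩, hk, hr⟩, fun s z => ?_, hk', fun z => ?_⟩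
  · obtain ⟨y, rfl⟩ := hE z
    rw [hk', hr']
  · obtain ⟨y, rfl⟩ := hF z
    rw [hr', hk']
  · obtain ⟨y, rfl⟩ := hE z
    change k (s • E.p y) = s • k (E.p y)
    rw [← E.isFactorMap_p.map_smul, hk', hk', F.isFactorMap_p.map_smul]
  · obtain ⟨y, rfl⟩ := hE z
    change E.q (E.p y) = F.q (k (E.p y))
    rw [hk', E.comp_eq, F.comp_eq]

/-! #### Every intermediate `Γ`-C*-algebra comes from an intermediate extension -/

/-- The equivalence relation on `Y` defined by a C*-subalgebra of `C₀(Y)`. -/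
def relOf (A : CStarSubalgebra C₀(Y, ℂ)) : Setoid Y where
  r y y' := ∀ a ∈ A.1, a y = a y'
  iseqv := ⟨fun _ _ _ => rfl, fun h a ha => (h a ha).symm,
    fun h h' a ha => (h a ha).trans (h' a ha)⟩

variable [LocallyCompactSpace X]

theorem exists_extension {π : ProperFactorMap Γ Y X} (A : intermediateAlgebras π) :
    ∃ E : IntermediateExtension π, E.algebra = A := by
  obtain ⟨A, hA, hA'⟩ := A
  let Z := Quotient (relOf A)
  let p : Y → Z := Quotient.mk _
  have hp : IsQuotientMap p := isQuotientMap_quot_mk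
  have hpe : ∀ {y y'}, p y = p y' ↔ ∀ a ∈ A.1, a y = a y' := Quotient.eq
  have hXA : ∀ f : C₀(X, ℂ), pullback π.toCocompactMap f ∈ A.1 := fun f => hA ⟨f, rfl⟩
  have hπ : ∀ y y', p y = p y' → π.toFun y = π.toFun y' := by
    intro y y' e
    by_contra hne
    obtain ⟨f, h1, h0⟩ := exists_zeroAtInfty_ne hne
    have h2 : f (π.toFun y) = f (π.toFun y') := hpe.1 e _ (hXA f)
    rw [h1, h0] at h2
    exact one_ne_zero h2
  let q : Z → X := Quotient.lift π.toFun fun y y' h => hπ y y' (Quotient.sound h)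
  have hqp : ∀ y, q (p y) = π.toFun y := fun _ => rfl
  have hqc : Continuous q := hp.continuous_iff.2 π.isFactorMap.isQuotientMap.continuous
  -- elements of `A` descend to `Z`
  have hdesc : ∀ a ∈ A.1, ∃ g : Z → ℂ, Continuous g ∧ ∀ y, g (p y) = a y := by
    intro a ha
    exact ⟨Quotient.lift a fun y y' h => h a ha, hp.continuous_iff.2 (map_continuous a),
      fun _ => rfl⟩
  have : T2Space Z := by
    refine ⟨fun z w hzw => ?_⟩
    obtain ⟨y, rfl⟩ := hp.surjective z
    obtain ⟨y', rfl⟩ := hp.surjective w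
    have := mt hpe.2 hzw
    push Not at this
    obtain ⟨a, ha, hne⟩ := this
    obtain ⟨g, hg, hga⟩ := hdesc a ha
    exact separated_by_continuous hg (by rwa [hga, hga])
  have hqK : ∀ K : Set X, IsCompact K → IsCompact (q ⁻¹' K) := by
    intro K hK
    have : q ⁻¹' K = p '' (π.toFun ⁻¹' K) := by
      ext z
      obtain ⟨y, rfl⟩ := hp.surjective z
      constructor
      · exact fun h => ⟨y, h, rfl⟩
      · rintro ⟨y', h', e⟩
        rw [← e]
        exact h'
    rw [this]
    exact (π.isCompact_preimage K hK).image hp.continuous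
  have : WeaklyLocallyCompactSpace Z := by
    refine ⟨fun z => ?_⟩
    obtain ⟨K, hK, hKz⟩ := exists_compact_mem_nhds (q z)
    exact ⟨q ⁻¹' K, hqK K hK, hqc.continuousAt hKz⟩
  have hact : ∀ (s : Γ) (y y' : Y), p y = p y' → p (s • y) = p (s • y') := by
    intro s y y' e
    refine hpe.2 fun a ha => ?_
    have := hpe.1 e _ (hA' s⁻¹ a ha)
    change a (s⁻¹⁻¹ • y) = a (s⁻¹⁻¹ • y') at this
    rwa [inv_inv] at this
  let _ : MulAction Γ Z :=
    { smul := fun s => Quotient.map (s • ·) fun y y' h =>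
        Quotient.exact (hact s y y' (Quotient.sound h))
      one_smul := by
        rintro ⟨y⟩
        exact congrArg p (one_smul Γ y)
      mul_smul := by
        rintro s t ⟨y⟩
        exact congrArg p (mul_smul s t y) }
  have hps : ∀ (s : Γ) (y : Y), p (s • y) = s • p y := fun _ _ => rfl
  have : ContinuousConstSMul Γ Z :=
    ⟨fun s => hp.continuous_iff.2 (hp.continuous.comp (continuous_const_smul s))⟩
  let E : IntermediateExtension π :=
    { Z := Z
      p := p
      q := q
      isFactorMap_p := ⟨hp, hps⟩
      isFactorMap_q := ⟨IsQuotientMap.of_comp hp.continuous hqc π.isFactorMap.isQuotientMap, by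
        intro s z
        obtain ⟨y, rfl⟩ := hp.surjective z
        exact π.isFactorMap.map_smul s y⟩
      comp_eq := hqp }
  refine ⟨E, Subtype.ext (le_antisymm ?_ ?_)⟩
  · -- the Stone–Weierstrass theorem on the one-point compactification of `Z`
    let T : C(OnePoint Z, ℂ) →ₗ[ℂ] C₀(Y, ℂ) :=
      { toFun := fun g =>
          { toFun := fun y => g (p y : OnePoint Z) - g OnePoint.infty
            continuous_toFun := (g.continuous.comp
              (OnePoint.continuous_coe.comp hp.continuous)).sub continuous_const
            zero_at_infty' := by
              have h1 : Tendsto (fun z : Z => g (z : OnePoint Z)) (coclosedCompact Z)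
                  (𝓝 (g OnePoint.infty)) :=
                OnePoint.continuousAt_infty'.1 g.continuous.continuousAt
              rw [coclosedCompact_eq_cocompact] at h1
              have h2 := h1.comp (cocompact_tendsto E.toCocompactMap)
              have h3 := h2.sub_const (g OnePoint.infty)
              rw [sub_self] at h3
              exact h3 }
        map_add' := fun g h => by
          ext y
          change (g _ + h _) - (g _ + h _) = (g _ - g _) + (h _ - h _)
          ring
        map_smul' := fun c g => by
          ext y
          change c * g _ - c * g _ = c * (g _ - g _)
          ring }
    have hT : ∀ g y, T g y = g (p y : OnePoint Z) - g OnePoint.infty := fun _ _ => rfl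
    have hTc : Continuous T := by
      refine AddMonoidHomClass.continuous_of_bound T 2 fun g => ?_
      rw [← ZeroAtInftyContinuousMap.norm_toBCF_eq_norm]
      refine (BoundedContinuousFunction.norm_le (by positivity)).2 fun y => ?_
      change ‖g (p y : OnePoint Z) - g OnePoint.infty‖ ≤ 2 * ‖g‖
      refine (norm_sub_le _ _).trans ?_
      rw [two_mul]
      exact add_le_add (g.norm_coe_le_norm _) (g.norm_coe_le_norm _)
    let B : StarSubalgebra ℂ C(OnePoint Z, ℂ) :=
      { carrier := {g | T g ∈ A.1}
        mul_mem' := by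
          intro g h hg hh
          have e : T (g * h) = T g * T h + h OnePoint.infty • T g + g OnePoint.infty • T h := by
            ext y
            simp only [ZeroAtInftyContinuousMap.coe_add, ZeroAtInftyContinuousMap.coe_mul,
              ZeroAtInftyContinuousMap.coe_smul, Pi.add_apply, Pi.mul_apply, Pi.smul_apply, hT,
              ContinuousMap.mul_apply, smul_eq_mul]
            ring
          change T (g * h) ∈ A.1
          rw [e]
          exact add_mem (add_mem (mul_mem hg hh) (SMulMemClass.smul_mem _ hg))
            (SMulMemClass.smul_mem _ hh)
        add_mem' := by
          intro g h hg hh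
          change T (g + h) ∈ A.1
          rw [map_add]
          exact add_mem hg hh
        algebraMap_mem' := by
          intro c
          have e : T (algebraMap ℂ _ c) = 0 := by
            ext y
            simp [hT]
          change T (algebraMap ℂ _ c) ∈ A.1
          rw [e]
          exact zero_mem _
        star_mem' := by
          intro g hg
          have e : T (star g) = star (T g) := by
            ext y
            simp [hT]
          change T (star g) ∈ A.1
          rw [e]
          exact star_mem hg }
    have hBc : IsClosed (B : Set C(OnePoint Z, ℂ)) := A.2.preimage hTc
    -- elements of `A` extend to the one-point compactification
    have hext : ∀ a ∈ A.1, ∃ g ∈ B, (∀ y, g (p y : OnePoint Z) = a y) ∧ g OnePoint.infty = 0 := by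
      intro a ha
      obtain ⟨g, hg, hga⟩ := hdesc a ha
      have hg0 : Tendsto g (coclosedCompact Z) (𝓝 0) := by
        rw [coclosedCompact_eq_cocompact, Metric.tendsto_nhds]
        intro ε hε
        have h1 := (Metric.tendsto_nhds.1 (zero_at_infty a)) ε hε
        obtain ⟨K, hK, hKa⟩ := mem_cocompact.1 h1
        refine mem_cocompact.2 ⟨p '' K, hK.image hp.continuous, fun z hz => ?_⟩
        obtain ⟨y, rfl⟩ := hp.surjective z
        have : y ∉ K := fun hy => hz ⟨y, hy, rfl⟩
        change dist (g (p y)) 0 < ε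
        rw [hga]
        exact hKa this
      let G : C(OnePoint Z, ℂ) :=
        { toFun := fun z => OnePoint.elim z 0 g
          continuous_toFun := (OnePoint.continuous_iff _).2 ⟨hg0, hg⟩ }
      have hGp : ∀ y, G (p y : OnePoint Z) = a y := hga
      have hG0 : G OnePoint.infty = 0 := rfl
      refine ⟨G, ?_, hGp, hG0⟩
      have e : T G = a := by
        ext y
        rw [hT, hGp, hG0, sub_zero]
      change T G ∈ A.1
      rwa [e]
    have hsep : B.toSubalgebra.SeparatesPoints := by
      have hinf : ∀ z : Z, ∃ g ∈ B, g (z : OnePoint Z) ≠ g OnePoint.infty := by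
        intro z
        obtain ⟨y, rfl⟩ := hp.surjective z
        obtain ⟨f, hf1, -, hfc, -⟩ := exists_continuous_one_zero_of_isCompact
          (isCompact_singleton (x := π.toFun y)) isClosed_empty (by simp)
        let f' : C₀(X, ℂ) := ⟨⟨fun x => (f x : ℂ), by fun_prop⟩,
          (hfc.comp_left (g := fun r : ℝ => (r : ℂ)) (by simp)).is_zero_at_infty⟩
        obtain ⟨g, hg, hga, hg0⟩ := hext _ (hXA f')
        refine ⟨g, hg, ?_⟩
        rw [hga, hg0]
        have : f (π.toFun y) = 1 := hf1 (Set.mem_singleton _)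
        change ((f (π.toFun y) : ℝ) : ℂ) ≠ 0
        rw [this]
        simp
      intro z w hzw
      induction z using OnePoint.rec with
      | infty =>
        induction w using OnePoint.rec with
        | infty => exact absurd rfl hzw
        | coe w =>
          obtain ⟨g, hg, hne⟩ := hinf w
          exact ⟨g, ⟨g, hg, rfl⟩, hne.symm⟩
      | coe z =>
        induction w using OnePoint.rec with
        | infty =>
          obtain ⟨g, hg, hne⟩ := hinf z
          exact ⟨g, ⟨g, hg, rfl⟩, hne⟩
        | coe w =>
          obtain ⟨y, rfl⟩ := hp.surjective z
          obtain ⟨y', rfl⟩ := hp.surjective w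
          have := mt hpe.2 (fun e => hzw (congrArg _ e))
          push Not at this
          obtain ⟨a, ha, hne⟩ := this
          obtain ⟨g, hg, hga, -⟩ := hext a ha
          exact ⟨g, ⟨g, hg, rfl⟩, by rwa [hga, hga]⟩
    have hB : ∀ g, g ∈ B := by
      intro g
      have h1 := ContinuousMap.starSubalgebra_topologicalClosure_eq_top_of_separatesPoints B hsep
      have h2 : g ∈ B.topologicalClosure := by rw [h1]; trivial
      exact (StarSubalgebra.topologicalClosure_minimal le_rfl hBc) h2
    rintro _ ⟨f, rfl⟩
    let G : C(OnePoint Z, ℂ) :=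
      { toFun := fun z => OnePoint.elim z 0 f
        continuous_toFun := (OnePoint.continuous_iff _).2 ⟨by
          rw [coclosedCompact_eq_cocompact]
          exact zero_at_infty f, map_continuous f⟩ }
    have e : T G = pullback E.toCocompactMap f := by
      ext y
      exact sub_zero _
    have := hB G
    change T G ∈ A.1 at this
    rw [e] at this
    exact this
  · intro a ha
    obtain ⟨g, hg, hga⟩ := hdesc a ha
    refine mem_algebra.2 ⟨⟨⟨g, hg⟩, ?_⟩, hga⟩
    rw [Metric.tendsto_nhds]
    intro ε hε
    have h1 := (Metric.tendsto_nhds.1 (zero_at_infty a)) ε hε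
    obtain ⟨K, hK, hKa⟩ := mem_cocompact.1 h1
    refine mem_cocompact.2 ⟨p '' K, hK.image hp.continuous, fun z hz => ?_⟩
    obtain ⟨y, rfl⟩ := hp.surjective z
    have : y ∉ K := fun hy => hz ⟨y, hy, rfl⟩
    change dist (g (p y)) 0 < ε
    rw [hga]
    exact hKa this

end IntermediateExtension

namespace ExtensionClass

variable [LocallyCompactSpace X]

/-- The bijection `Z ↦ C₀(Z)` of Gelfand duality between the classes of intermediate extensions
and the intermediate `Γ`-C*-algebras of `C₀(X) ⊆ C₀(Y)`. -/
def gelfand (π : ProperFactorMap Γ Y X) : ExtensionClass π ≃ intermediateAlgebras π :=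
  Equiv.ofBijective
    (Quotient.lift IntermediateExtension.algebra fun _ _ => IntermediateExtension.algebra_congr) (by
    constructor
    · rintro ⟨E⟩ ⟨F⟩ h
      exact Quotient.sound (IntermediateExtension.equivalent_of_algebra_eq h)
    · intro A
      obtain ⟨E, hE⟩ := IntermediateExtension.exists_extension A
      exact ⟨Quotient.mk _ E, hE⟩)

/-- The lattice structure on the classes of intermediate extensions induced by Gelfand duality. -/
instance (π : ProperFactorMap Γ Y X) : Lattice (ExtensionClass π) where
  le a b := gelfand π a ≤ gelfand π b
  le_refl _ := le_rfl
  le_trans _ _ _ h₁ h₂ := h₁.trans h₂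
  le_antisymm _ _ h₁ h₂ := (gelfand π).injective (le_antisymm h₁ h₂)
  sup a b := (gelfand π).symm (gelfand π a ⊔ gelfand π b)
  le_sup_left _ _ := by simp
  le_sup_right _ _ := by simp
  sup_le _ _ _ h₁ h₂ := by simpa using ⟨h₁, h₂⟩
  inf a b := (gelfand π).symm (gelfand π a ⊓ gelfand π b)
  inf_le_left _ _ := by simp
  inf_le_right _ _ := by simp
  le_inf _ _ _ h₁ h₂ := by simpa using ⟨h₁, h₂⟩

end ExtensionClass

/-! ### The crossed products attached to an extension -/

/-- The reduced crossed product `C₀(W) ⋊_r Γ` of a factor `g : Y → W` of `Y`, as a C*-subalgebra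
of the operators on `ℓ²(Γ, ℓ²(Y))`; `C₀(W)` is represented faithfully on `ℓ²(Y)` by multiplication
with the functions `f ∘ g`. -/
def factorCrossedProduct (Γ : Type*) {Y W : Type*} [Group Γ] [TopologicalSpace Y]
    [TopologicalSpace W] [MulAction Γ W] [ContinuousConstSMul Γ W] (g : CocompactMap Y W) :
    CStarSubalgebra (L2 Γ (L2 Y ℂ) →L[ℂ] L2 Γ (L2 Y ℂ)) :=
  reducedCrossedProduct (functionAction Γ W) ((multiplicationRep Y).comp (pullback g))

end Extensions

end

end CrossedExt

open CrossedExt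

/-!
The approximation property detects a crossed product by its coefficients: if a limit of finite sums
`∑ b_s λ_s` has all its coefficients in an invariant C*-subalgebra `D`, then a bounded functional
vanishing on `D ⋊ Γ` vanishes on the limit, because `φ ↦ ω (∑ φ(s) b_s λ_s)` passes to a functional
in the predual of the multipliers which kills the finitely supported ones, and hence `1`.

It remains to see that an algebra `B` between `C₀(X) ⋊ Γ` and `C₀(Y) ⋊ Γ` contains the coefficients
of its elements. Since `Γ` acts freely on `X`, a compact subset of `X` is covered by finitely many
open sets that are disjoint from their translates by a given finite set of group elements. With
`∑ p_i²` a subordinate partition of unity, the contraction `x ↦ ∑ p_i x λ_s⁻¹ p_i` leaves `B`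
invariant and sends `∑ b_t λ_t` to approximately `b_s`. Thus `B = (B ∩ C₀(Y)) ⋊ Γ`.
-/

namespace CrossedExt

open Topology Filter
open scoped ENNReal ZeroAtInfty InnerProductSpace

noncomputable section

/-! ### Translations -/

section Translation

variable {Γ H : Type*} [Group Γ] [NormedAddCommGroup H] [InnerProductSpace ℂ H]

@[simp]
theorem translation_apply (s : Γ) (ξ : L2 Γ H) (t : Γ) : translation s ξ t = ξ (s⁻¹ * t) := rfl

@[simp]
theorem translation_one : (translation 1 : L2 Γ H →L[ℂ] L2 Γ H) = 1 := by
  ext ξ t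
  simp

theorem translation_mul (s t : Γ) :
    (translation s * translation t : L2 Γ H →L[ℂ] L2 Γ H) = translation (s * t) := by
  ext ξ r
  simp [mul_assoc]

variable [CompleteSpace H]

theorem star_translation (s : Γ) :
    star (translation s : L2 Γ H →L[ℂ] L2 Γ H) = translation s⁻¹ := by
  symm
  rw [ContinuousLinearMap.star_eq_adjoint, ContinuousLinearMap.eq_adjoint_iff]
  intro ξ η
  rw [lp.inner_eq_tsum, lp.inner_eq_tsum, ← (Equiv.mulLeft s⁻¹).tsum_eq]
  simp

theorem translation_mem_unitary (s : Γ) :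
    (translation s : L2 Γ H →L[ℂ] L2 Γ H) ∈ unitary (L2 Γ H →L[ℂ] L2 Γ H) := by
  rw [Unitary.mem_iff, star_translation, translation_mul, translation_mul]
  simp

theorem norm_mul_translation (x : L2 Γ H →L[ℂ] L2 Γ H) (s : Γ) : ‖x * translation s‖ = ‖x‖ :=
  CStarRing.norm_mul_mem_unitary x (translation_mem_unitary s)

end Translation

/-! ### Completely bounded multipliers act as Schur multipliers -/

section Schur

variable {Γ : Type*} [Group Γ] {n : ℕ}

local notation "𝓔" n => EuclideanSpace ℂ (Fin n)

local notation:max "𝐞[" i "]" => EuclideanSpace.single i (1 : ℂ)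

@[simp]
theorem tensorTranslation_apply (T : (𝓔 n) →L[ℂ] 𝓔 n) (s : Γ) (ξ : L2 Γ (𝓔 n)) (t : Γ) :
    tensorTranslation T s ξ t = T (ξ (s⁻¹ * t)) := rfl

theorem tensorTranslation_mul (S T : (𝓔 n) →L[ℂ] 𝓔 n) (s t : Γ) :
    tensorTranslation S s * tensorTranslation T t = tensorTranslation (S * T) (s * t) := by
  ext ξ r i
  simp [mul_assoc]

theorem star_tensorTranslation (T : (𝓔 n) →L[ℂ] 𝓔 n) (s : Γ) :
    star (tensorTranslation T s) = tensorTranslation (star T) s⁻¹ := by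
  symm
  rw [ContinuousLinearMap.star_eq_adjoint (tensorTranslation T s),
    ContinuousLinearMap.eq_adjoint_iff]
  intro ξ η
  rw [lp.inner_eq_tsum, lp.inner_eq_tsum, ← (Equiv.mulLeft s⁻¹).tsum_eq]
  simp [ContinuousLinearMap.star_eq_adjoint, ContinuousLinearMap.adjoint_inner_left]

theorem tensorTranslation_one_one : tensorTranslation (1 : (𝓔 n) →L[ℂ] 𝓔 n) (1 : Γ) = 1 := by
  ext ξ r i
  simp

theorem norm_tensorTranslation_one (T : (𝓔 n) →L[ℂ] 𝓔 n) :
    ‖tensorTranslation T (1 : Γ)‖ = ‖T‖ := by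
  classical
  refine le_antisymm ?_ (ContinuousLinearMap.opNorm_le_bound _ (norm_nonneg _) fun x => ?_)
  · rw [tensorTranslation, translation_one]
    exact lp.norm_mapCLM_le 2 _ (norm_nonneg T) fun _ => le_rfl
  · have map_single : tensorTranslation T (1 : Γ) (lp.single 2 1 x) = lp.single 2 1 (T x) := by
      ext r : 2
      rw [tensorTranslation_apply, inv_one, one_mul, lp.single_apply, lp.single_apply]
      exact Pi.apply_single (fun _ => T) (fun _ => map_zero T) 1 x r
    simpa [map_single] using (tensorTranslation T (1 : Γ)).le_opNorm (lp.single 2 1 x)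

/-- The linear map `T ↦ T ⊗ λ_s`. -/
def tensorTranslationₗ (s : Γ) :
    ((𝓔 n) →L[ℂ] 𝓔 n) →ₗ[ℂ] (L2 Γ (𝓔 n) →L[ℂ] L2 Γ (𝓔 n)) where
  toFun T := tensorTranslation T s
  map_add' S T := by ext ξ r i; simp
  map_smul' c T := by ext ξ r i; simp

@[simp]
theorem tensorTranslationₗ_apply (s : Γ) (T : (𝓔 n) →L[ℂ] 𝓔 n) :
    tensorTranslationₗ s T = tensorTranslation T s := rfl

/-- The matrix unit `e_ij` of `M_n(ℂ)`. -/
def matrixUnit (i j : Fin n) : (𝓔 n) →L[ℂ] 𝓔 n :=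
  InnerProductSpace.rankOne ℂ 𝐞[i] 𝐞[j]

theorem sum_matrixUnit_self : ∑ i : Fin n, matrixUnit i i = 1 := by
  have := (EuclideanSpace.basisFun (Fin n) ℂ).sum_rankOne_eq_id
  simp only [EuclideanSpace.basisFun_apply] at this
  exact this

theorem star_matrixUnit (i j : Fin n) : star (matrixUnit i j) = matrixUnit j i :=
  InnerProductSpace.adjoint_rankOne _ _

theorem matrixUnit_mul_mul_matrixUnit (M : (𝓔 n) →L[ℂ] 𝓔 n) (i j : Fin n) :
    matrixUnit i i * M * matrixUnit j j = ⟪𝐞[i], M 𝐞[j]⟫_ℂ • matrixUnit i j := by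
  ext x : 1
  simp only [matrixUnit, mul_apply_eq_comp, smul_apply, InnerProductSpace.rankOne_apply, map_smul]
  exact smul_comm _ _ _

theorem matrixUnit_mul_self (i j : Fin n) :
    matrixUnit i i * matrixUnit j j = if i = j then matrixUnit i i else 0 := by
  have h := matrixUnit_mul_mul_matrixUnit 1 i j
  rw [mul_one] at h
  rcases eq_or_ne i j with rfl | hij
  · simpa using h
  · rw [h, if_neg hij, one_apply_eq_self, EuclideanSpace.orthonormal_single.inner_eq_zero hij]
    exact zero_smul ℂ (matrixUnit i j)

/-- The unitary `∑ᵢ eᵢᵢ ⊗ λ_{gᵢ}` on `ℂⁿ ⊗ ℓ²(Γ)`. -/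
def diagTranslation (g : Fin n → Γ) : L2 Γ (𝓔 n) →L[ℂ] L2 Γ (𝓔 n) :=
  ∑ i, tensorTranslation (matrixUnit i i) (g i)

theorem star_diagTranslation (g : Fin n → Γ) :
    star (diagTranslation g) = diagTranslation fun i => (g i)⁻¹ := by
  simp only [diagTranslation, star_sum, star_tensorTranslation, star_matrixUnit]

theorem diagTranslation_mul_mul_inv (g : Fin n → Γ) (M : (𝓔 n) →L[ℂ] 𝓔 n) :
    diagTranslation g * tensorTranslation M 1 * diagTranslation (fun i => (g i)⁻¹) =
      ∑ i, ∑ j, ⟪𝐞[i], M 𝐞[j]⟫_ℂ • tensorTranslation (matrixUnit i j) (g i * (g j)⁻¹) := by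
  simp only [diagTranslation, Finset.sum_mul, Finset.mul_sum, tensorTranslation_mul, mul_one,
    matrixUnit_mul_mul_matrixUnit]
  simp only [← tensorTranslationₗ_apply, map_smul]
  exact Finset.sum_comm

theorem diagTranslation_mul_inv (g : Fin n → Γ) :
    diagTranslation g * diagTranslation (fun i => (g i)⁻¹) = 1 := by
  have h (i j : Fin n) :
      tensorTranslation (matrixUnit i i) (g i) * tensorTranslation (matrixUnit j j) (g j)⁻¹ =
        if i = j then tensorTranslationₗ (1 : Γ) (matrixUnit i i) else 0 := by
    rw [tensorTranslation_mul, matrixUnit_mul_self, ← tensorTranslationₗ_apply]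
    split_ifs with hij
    · rw [hij, mul_inv_cancel]
    · exact map_zero _
  simp only [diagTranslation, Finset.sum_mul_sum, h, Finset.sum_ite_eq, Finset.mem_univ, if_true]
  rw [← map_sum, sum_matrixUnit_self, tensorTranslationₗ_apply, tensorTranslation_one_one]

theorem diagTranslation_mem_unitary (g : Fin n → Γ) :
    diagTranslation g ∈ unitary (L2 Γ (𝓔 n) →L[ℂ] L2 Γ (𝓔 n)) := by
  rw [Unitary.mem_iff, star_diagTranslation]
  refine ⟨?_, diagTranslation_mul_inv g⟩
  simpa using diagTranslation_mul_inv fun i => (g i)⁻¹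

theorem norm_sum_inner_smul_tensorTranslation (g : Fin n → Γ) (M : (𝓔 n) →L[ℂ] 𝓔 n) :
    ‖∑ i, ∑ j, ⟪𝐞[i], M 𝐞[j]⟫_ℂ • tensorTranslation (matrixUnit i j) (g i * (g j)⁻¹)‖ = ‖M‖ := by
  rw [← diagTranslation_mul_mul_inv, ← star_diagTranslation,
    CStarRing.norm_mul_mem_unitary _ (Unitary.star_mem (diagTranslation_mem_unitary g)),
    CStarRing.norm_mem_unitary_mul _ (diagTranslation_mem_unitary g), norm_tensorTranslation_one]

variable {φ : Γ → ℂ} {C : ℝ}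

theorem IsCBMultiplierWith.nonneg (hφ : IsCBMultiplierWith φ C) : 0 ≤ C := by
  have h := hφ 1 (Finsupp.single 1 1)
  simp only [← tensorTranslationₗ_apply, smul_zero, map_zero, Finsupp.sum_single_index] at h
  rw [tensorTranslationₗ_apply, norm_tensorTranslation_one, norm_one, mul_one] at h
  exact (norm_nonneg _).trans h

theorem IsCBMultiplierWith.norm_matrix_le (hφ : IsCBMultiplierWith φ C) (g : Fin n → Γ)
    {M M' : (𝓔 n) →L[ℂ] 𝓔 n}
    (h : ∀ i j, ⟪𝐞[i], M' 𝐞[j]⟫_ℂ = φ (g i * (g j)⁻¹) * ⟪𝐞[i], M 𝐞[j]⟫_ℂ) :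
    ‖M'‖ ≤ C * ‖M‖ := by
  classical
  let b : Γ →₀ ((𝓔 n) →L[ℂ] 𝓔 n) :=
    ∑ i, ∑ j, Finsupp.single (g i * (g j)⁻¹) (⟪𝐞[i], M 𝐞[j]⟫_ℂ • matrixUnit i j)
  have sum_b (ψ : Γ → ℂ) : (b.sum fun s T => ψ s • tensorTranslation T s) =
      ∑ i, ∑ j, (ψ (g i * (g j)⁻¹) * ⟪𝐞[i], M 𝐞[j]⟫_ℂ) •
        tensorTranslation (matrixUnit i j) (g i * (g j)⁻¹) := by
    change Finsupp.lsum ℂ (fun s => ψ s • tensorTranslationₗ (n := n) s) b = _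
    simp only [b, map_sum, Finsupp.lsum_single, LinearMap.smul_apply, map_smul,
      tensorTranslationₗ_apply, mul_comm (ψ _), mul_smul]
  have hb := hφ n b
  have sum_one := sum_b fun _ => 1
  simp only [one_smul, one_mul] at sum_one
  simp only [sum_b, ← h] at hb
  rwa [sum_one, norm_sum_inner_smul_tensorTranslation,
    norm_sum_inner_smul_tensorTranslation] at hb

variable {ι K : Type*} [NormedAddCommGroup K] [InnerProductSpace ℂ K]

theorem exists_linearIsometry_of_orthonormal {v : Fin n → K} (hv : Orthonormal ℂ v) :
    ∃ V : (𝓔 n) →ₗᵢ[ℂ] K, ∀ i, V 𝐞[i] = v i := by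
  let e := (EuclideanSpace.basisFun (Fin n) ℂ).toBasis
  have he (i : Fin n) : e i = 𝐞[i] := by simp [e]
  have h_comp : e.constr ℂ v ∘ e = v := funext (e.constr_basis ℂ v)
  refine ⟨(e.constr ℂ v).isometryOfOrthonormal (v := e) ?_ (by rwa [h_comp]), fun i => ?_⟩
  · rw [funext he]
    exact EuclideanSpace.orthonormal_single
  · rw [← he]
    exact congrFun h_comp i

theorem exists_linearIsometry_span_le_range {b : ι → K} (hb : Orthonormal ℂ b) (F : Finset ι) :
    ∃ (n : ℕ) (f : Fin n → ι) (V : (𝓔 n) →ₗᵢ[ℂ] K), (∀ k, V 𝐞[k] = b (f k)) ∧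
      Submodule.span ℂ (b '' F) ≤ LinearMap.range V.toLinearMap := by
  obtain ⟨V, hV⟩ := exists_linearIsometry_of_orthonormal
    (hb.comp _ (Subtype.val_injective.comp F.equivFin.symm.injective))
  refine ⟨F.card, fun k => F.equivFin.symm k, V, hV, Submodule.span_le.2 ?_⟩
  rintro _ ⟨i, hi, rfl⟩
  exact ⟨_, (hV (F.equivFin ⟨i, hi⟩)).trans (by simp)⟩

variable [CompleteSpace K]

/-- The compression `V* T V` of an operator to the domain of an isometry `V`. -/
def isometricCompression (V : (𝓔 n) →ₗᵢ[ℂ] K) (T : K →L[ℂ] K) : (𝓔 n) →L[ℂ] 𝓔 n :=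
  V.toContinuousLinearMap.adjoint ∘L T ∘L V.toContinuousLinearMap

theorem inner_isometricCompression (V : (𝓔 n) →ₗᵢ[ℂ] K) (T : K →L[ℂ] K) (x y : 𝓔 n) :
    ⟪x, isometricCompression V T y⟫_ℂ = ⟪V x, T (V y)⟫_ℂ := by
  simp [isometricCompression, ContinuousLinearMap.adjoint_inner_right]

theorem norm_isometricCompression_le (V : (𝓔 n) →ₗᵢ[ℂ] K) (T : K →L[ℂ] K) :
    ‖isometricCompression V T‖ ≤ ‖T‖ := by
  have norm_adjoint_le : ‖V.toContinuousLinearMap.adjoint‖ ≤ 1 := by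
    rw [LinearIsometryEquiv.norm_map]
    exact V.norm_toContinuousLinearMap_le
  refine (ContinuousLinearMap.opNorm_comp_le _ _).trans ?_
  refine (mul_le_of_le_one_left (norm_nonneg _) norm_adjoint_le).trans ?_
  refine (ContinuousLinearMap.opNorm_comp_le _ _).trans ?_
  exact mul_le_of_le_one_right (norm_nonneg _) V.norm_toContinuousLinearMap_le

theorem IsCBMultiplierWith.norm_inner_le_of_linearIsometry (hφ : IsCBMultiplierWith φ C)
    (V : (𝓔 n) →ₗᵢ[ℂ] K) (g : Fin n → Γ) {T T' : K →L[ℂ] K}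
    (h : ∀ i j, ⟪V 𝐞[i], T' (V 𝐞[j])⟫_ℂ = φ (g i * (g j)⁻¹) * ⟪V 𝐞[i], T (V 𝐞[j])⟫_ℂ)
    (x y : 𝓔 n) : ‖⟪V y, T' (V x)⟫_ℂ‖ ≤ C * ‖T‖ * ‖x‖ * ‖y‖ := by
  have schur : ‖isometricCompression V T'‖ ≤ C * ‖T‖ :=
    (hφ.norm_matrix_le g (M := isometricCompression V T) fun i j => by
      simp only [inner_isometricCompression, h]).trans
        (mul_le_mul_of_nonneg_left (norm_isometricCompression_le V T) hφ.nonneg)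
  rw [← inner_isometricCompression]
  calc ‖⟪y, isometricCompression V T' x⟫_ℂ‖ ≤ ‖y‖ * (‖isometricCompression V T'‖ * ‖x‖) :=
        (norm_inner_le_norm _ _).trans
          (mul_le_mul_of_nonneg_left (ContinuousLinearMap.le_opNorm _ _) (norm_nonneg y))
    _ ≤ ‖y‖ * (C * ‖T‖ * ‖x‖) := by gcongr
    _ = C * ‖T‖ * ‖x‖ * ‖y‖ := by ring

theorem IsCBMultiplierWith.norm_inner_le_of_orthonormal (hφ : IsCBMultiplierWith φ C)
    {b : ι → K} (hb : Orthonormal ℂ b) (g : ι → Γ) {T T' : K →L[ℂ] K}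
    (h : ∀ i j, ⟪b i, T' (b j)⟫_ℂ = φ (g i * (g j)⁻¹) * ⟪b i, T (b j)⟫_ℂ) {ξ η : K}
    (hξ : ξ ∈ Submodule.span ℂ (Set.range b)) (hη : η ∈ Submodule.span ℂ (Set.range b)) :
    ‖⟪η, T' ξ⟫_ℂ‖ ≤ C * ‖T‖ * ‖ξ‖ * ‖η‖ := by
  classical
  obtain ⟨c, rfl⟩ := Finsupp.mem_span_range_iff_exists_finsupp.1 hξ
  obtain ⟨d, rfl⟩ := Finsupp.mem_span_range_iff_exists_finsupp.1 hη
  obtain ⟨n, f, V, hVf, hV⟩ := exists_linearIsometry_span_le_range hb (c.support ∪ d.support)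
  have mem_range (a : ι →₀ ℂ) (ha : a.support ⊆ c.support ∪ d.support) :
      (a.sum fun i z => z • b i) ∈ LinearMap.range V.toLinearMap :=
    sum_mem fun i hi => Submodule.smul_mem _ _ (hV (Submodule.subset_span ⟨i, ha hi, rfl⟩))
  obtain ⟨x, hx⟩ := mem_range c Finset.subset_union_left
  obtain ⟨y, hy⟩ := mem_range d Finset.subset_union_right
  rw [← hx, ← hy]
  simpa using hφ.norm_inner_le_of_linearIsometry V (fun k => g (f k))
    (fun i j => by rw [hVf, hVf, h]) x y

theorem IsCBMultiplierWith.norm_le_of_hilbertBasis (hφ : IsCBMultiplierWith φ C)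
    (b : HilbertBasis ι ℂ K) (g : ι → Γ) {T T' : K →L[ℂ] K}
    (h : ∀ i j, ⟪b i, T' (b j)⟫_ℂ = φ (g i * (g j)⁻¹) * ⟪b i, T (b j)⟫_ℂ) :
    ‖T'‖ ≤ C * ‖T‖ := by
  have dense_span : Dense (Submodule.span ℂ (Set.range b) : Set K) := by
    rw [Submodule.dense_iff_topologicalClosure_eq_top]
    exact b.dense_span
  have norm_inner_le (ξ η : K) : ‖⟪η, T' ξ⟫_ℂ‖ ≤ C * ‖T‖ * ‖ξ‖ * ‖η‖ :=
    isClosed_property2 (e := ((↑) : Submodule.span ℂ (Set.range b) → K))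
      (p := fun ξ η => ‖⟪η, T' ξ⟫_ℂ‖ ≤ C * ‖T‖ * ‖ξ‖ * ‖η‖) dense_span.denseRange_val
      (isClosed_le (by fun_prop) (by fun_prop))
      (fun ξ η => hφ.norm_inner_le_of_orthonormal b.orthonormal g h ξ.2 η.2) ξ η
  refine ContinuousLinearMap.opNorm_le_of_re_inner_le
    (mul_nonneg hφ.nonneg (norm_nonneg T)) fun ξ η hξ hη => ?_
  rw [← inner_conj_symm, RCLike.conj_re]
  simpa [hξ, hη] using (RCLike.re_le_norm _).trans (norm_inner_le ξ η)

end Schur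

/-! ### The regular covariant representation -/

section Regular

variable {Γ A H : Type*} [Group Γ] [NonUnitalCStarAlgebra A] [NormedAddCommGroup H]
  [InnerProductSpace ℂ H] [CompleteSpace H] (α : Γ →* (A →⋆ₙₐ[ℂ] A))
  (ρ : A →⋆ₙₐ[ℂ] (H →L[ℂ] H))

/-- The regular representation of `A` on `ℓ²(Γ, H)`, as a *-homomorphism. -/
def regularHom : A →⋆ₙₐ[ℂ] (L2 Γ H →L[ℂ] L2 Γ H) where
  toFun := regularRep α ρ
  map_smul' c a := by
    ext ξ t
    simp [regularRep]
  map_zero' := by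
    ext ξ t
    simp [regularRep]
  map_add' a b := by
    ext ξ t
    simp [regularRep]
  map_mul' a b := by
    ext ξ t
    simp [regularRep]
  map_star' a := by
    rw [ContinuousLinearMap.star_eq_adjoint, ContinuousLinearMap.eq_adjoint_iff]
    intro ξ η
    rw [lp.inner_eq_tsum, lp.inner_eq_tsum]
    refine tsum_congr fun t => ?_
    simp only [regularRep, lp.mapCLM_apply_coe, map_star]
    rw [ContinuousLinearMap.star_eq_adjoint, ContinuousLinearMap.adjoint_inner_left]

@[simp]
theorem regularHom_apply (a : A) (ξ : L2 Γ H) (t : Γ) :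
    regularHom α ρ a ξ t = ρ (α t⁻¹ a) (ξ t) := rfl

theorem norm_regularHom_le (a : A) : ‖regularHom α ρ a‖ ≤ ‖a‖ :=
  NonUnitalStarAlgHom.norm_apply_le (regularHom α ρ) a

theorem continuous_regularHom : Continuous (regularHom α ρ) :=
  AddMonoidHomClass.continuous_of_bound (regularHom α ρ) 1 fun a => by
    simpa using norm_regularHom_le α ρ a

theorem translation_mul_regularHom (s : Γ) (a : A) :
    translation s * regularHom α ρ a = regularHom α ρ (α s a) * translation s := by
  ext ξ t
  have h : α t⁻¹ (α s a) = α (t⁻¹ * s) a := by rw [map_mul]; rfl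
  simp [h]

theorem regularHom_mul_translation_mul (a b : A) (s t : Γ) :
    (regularHom α ρ a * translation s) * (regularHom α ρ b * translation t) =
      regularHom α ρ (a * α s b) * translation (s * t) := by
  rw [mul_assoc, ← mul_assoc (translation s), translation_mul_regularHom, mul_assoc,
    translation_mul, map_mul, mul_assoc]

theorem star_regularHom_mul_translation (a : A) (s : Γ) :
    star (regularHom α ρ a * translation s) =
      regularHom α ρ (α s⁻¹ (star a)) * translation s⁻¹ := by
  rw [star_mul, star_translation, ← map_star, translation_mul_regularHom]

/-- The finite sum `∑ φ(s) b_s λ_s` in the crossed product. -/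
def weightedSum (φ : Γ → ℂ) : (Γ →₀ A) →ₗ[ℂ] (L2 Γ H →L[ℂ] L2 Γ H) :=
  Finsupp.lsum ℂ fun s => φ s • LinearMap.mulRight ℂ (translation s : L2 Γ H →L[ℂ] L2 Γ H) ∘ₗ
    (regularHom α ρ : A →ₗ[ℂ] (L2 Γ H →L[ℂ] L2 Γ H))

theorem weightedSum_eq (φ : Γ → ℂ) (b : Γ →₀ A) :
    weightedSum α ρ φ b = b.sum fun s a => φ s • (regularHom α ρ a * translation s) := rfl

theorem weightedSum_single (φ : Γ → ℂ) (s : Γ) (a : A) :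
    weightedSum α ρ φ (Finsupp.single s a) = φ s • (regularHom α ρ a * translation s) := by
  rw [weightedSum, Finsupp.lsum_single]
  rfl

/-- The finite sum `∑ b_s λ_s` in the crossed product. -/
def crossedSum : (Γ →₀ A) →ₗ[ℂ] (L2 Γ H →L[ℂ] L2 Γ H) :=
  weightedSum α ρ fun _ => 1

theorem crossedSum_eq (b : Γ →₀ A) :
    crossedSum α ρ b = b.sum fun s a => regularHom α ρ a * translation s := by
  simp [crossedSum, weightedSum_eq]

theorem crossedSum_single (s : Γ) (a : A) :
    crossedSum α ρ (Finsupp.single s a) = regularHom α ρ a * translation s := by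
  rw [crossedSum, weightedSum_single, one_smul]

open Classical in
theorem weightedSum_lp_single_apply (φ : Γ → ℂ) (b : Γ →₀ A) (r t : Γ) (x : H) :
    weightedSum α ρ φ b (lp.single 2 r x) t =
      φ (t * r⁻¹) • ρ (α t⁻¹ (b (t * r⁻¹))) x := by
  induction b using Finsupp.induction_linear with
  | zero => simp
  | add b c hb hc => simp [hb, hc]
  | single s a =>
    rw [weightedSum_single]
    rcases eq_or_ne s (t * r⁻¹) with rfl | hs
    · simp
    · have hr : s⁻¹ * t ≠ r := by
        rwa [Ne, inv_mul_eq_iff_eq_mul, ← mul_inv_eq_iff_eq_mul, eq_comm]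
      simp [hr, Finsupp.single_eq_of_ne hs.symm]

theorem norm_coeff_le {ρ : A →⋆ₙₐ[ℂ] (H →L[ℂ] H)} (hρ : Function.Injective ρ) (b : Γ →₀ A)
    (s : Γ) : ‖b s‖ ≤ ‖crossedSum α ρ b‖ := by
  classical
  rw [← NonUnitalStarAlgHom.norm_map ρ hρ]
  refine ContinuousLinearMap.opNorm_le_bound _ (norm_nonneg _) fun x => ?_
  have h : crossedSum α ρ b (lp.single 2 s⁻¹ x) 1 = ρ (b s) x := by
    simp [crossedSum, weightedSum_lp_single_apply]
  rw [← h]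
  refine (lp.norm_apply_le_norm two_ne_zero _ _).trans ?_
  simpa using (crossedSum α ρ b).le_opNorm (lp.single 2 s⁻¹ x)

end Regular

section RegularBasis

variable {Γ H κ : Type*} [NormedAddCommGroup H] [InnerProductSpace ℂ H]

open Classical in
theorem orthonormal_lp_single {v : κ → H} (hv : Orthonormal ℂ v) :
    Orthonormal ℂ fun i : Γ × κ => (lp.single 2 i.1 (v i.2) : L2 Γ H) := by
  rw [orthonormal_iff_ite] at hv ⊢
  rintro ⟨s, j⟩ ⟨t, k⟩
  rw [lp.inner_single_left]
  rcases eq_or_ne s t with rfl | hst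
  · simp [hv]
  · simp [hst]

open Classical in
/-- The Hilbert basis `δ_t ⊗ e_k` of `ℓ²(Γ, H)`. -/
def regularBasis [CompleteSpace H] (e : HilbertBasis κ ℂ H) : HilbertBasis (Γ × κ) ℂ (L2 Γ H) :=
  HilbertBasis.mkOfOrthogonalEqBot (orthonormal_lp_single e.orthonormal) (by
    rw [Submodule.eq_bot_iff]
    intro ξ hξ
    ext t : 2
    refine e.repr.injective (lp.ext (funext fun k => ?_))
    have := (Submodule.mem_orthogonal _ _).1 hξ _ (Submodule.subset_span ⟨(t, k), rfl⟩)
    rw [lp.inner_single_left] at this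
    simpa [e.repr_apply_apply] using this)

open Classical in
theorem regularBasis_apply [CompleteSpace H] (e : HilbertBasis κ ℂ H) (i : Γ × κ) :
    regularBasis e i = (lp.single 2 i.1 (e i.2) : L2 Γ H) := by
  rw [regularBasis, HilbertBasis.coe_mkOfOrthogonalEqBot]

theorem IsCBMultiplierWith.norm_weightedSum_le [Group Γ] [CompleteSpace H] {A : Type*}
    [NonUnitalCStarAlgebra A] {φ : Γ → ℂ} {C : ℝ} (hφ : IsCBMultiplierWith φ C)
    (α : Γ →* (A →⋆ₙₐ[ℂ] A)) (ρ : A →⋆ₙₐ[ℂ] (H →L[ℂ] H)) (b : Γ →₀ A) :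
    ‖weightedSum α ρ φ b‖ ≤ C * ‖crossedSum α ρ b‖ := by
  classical
  obtain ⟨_, e, -⟩ := exists_hilbertBasis ℂ H
  refine hφ.norm_le_of_hilbertBasis (regularBasis e) Prod.fst fun i j => ?_
  simp only [regularBasis_apply, crossedSum, lp.inner_single_left, weightedSum_lp_single_apply,
    inner_smul_right, one_mul]

end RegularBasis

/-! ### Crossed products by invariant subalgebras -/

section CrossedProduct

variable {Γ A H : Type*} [Group Γ] [NonUnitalCStarAlgebra A] [NormedAddCommGroup H]
  [InnerProductSpace ℂ H] [CompleteSpace H]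

/-- The reduced crossed product `C ⋊ Γ` of an invariant C*-subalgebra `C` of `A`, realised inside
the operators on `ℓ²(Γ, H)`. -/
def crossedProduct (α : Γ →* (A →⋆ₙₐ[ℂ] A)) (ρ : A →⋆ₙₐ[ℂ] (H →L[ℂ] H)) (C : CStarSubalgebra A) :
    CStarSubalgebra (L2 Γ H →L[ℂ] L2 Γ H) :=
  CStarSubalgebra.generate {x | ∃ c ∈ C.1, ∃ s : Γ, regularHom α ρ c * translation s = x}

variable {α : Γ →* (A →⋆ₙₐ[ℂ] A)} {ρ : A →⋆ₙₐ[ℂ] (H →L[ℂ] H)} {C D : CStarSubalgebra A}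

theorem crossedProduct_le {B : CStarSubalgebra (L2 Γ H →L[ℂ] L2 Γ H)} :
    crossedProduct α ρ C ≤ B ↔ ∀ c ∈ C.1, ∀ s : Γ, regularHom α ρ c * translation s ∈ B.1 := by
  rw [crossedProduct, CStarSubalgebra.generate_le]
  constructor
  · exact fun h c hc s => h ⟨c, hc, s, rfl⟩
  · rintro h _ ⟨c, hc, s, rfl⟩
    exact h c hc s

theorem regularHom_mul_translation_mem_crossedProduct {c : A} (hc : c ∈ C.1) (s : Γ) :
    regularHom α ρ c * translation s ∈ (crossedProduct α ρ C).1 :=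
  crossedProduct_le.1 le_rfl c hc s

theorem regularHom_mem_crossedProduct {c : A} (hc : c ∈ C.1) :
    regularHom α ρ c ∈ (crossedProduct α ρ C).1 := by
  simpa using regularHom_mul_translation_mem_crossedProduct hc (1 : Γ)

theorem crossedProduct_mono (h : C ≤ D) : crossedProduct α ρ C ≤ crossedProduct α ρ D :=
  crossedProduct_le.2 fun _ hc s => regularHom_mul_translation_mem_crossedProduct (h hc) s

theorem exists_crossedSum_eq (hC : ∀ s, ∀ c ∈ C.1, α s c ∈ C.1) {x : L2 Γ H →L[ℂ] L2 Γ H}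
    (hx : x ∈ NonUnitalStarAlgebra.adjoin ℂ
      {x | ∃ c ∈ C.1, ∃ s : Γ, regularHom α ρ c * translation s = x}) :
    ∃ b : Γ →₀ A, (∀ s, b s ∈ C.1) ∧ crossedSum α ρ b = x := by
  classical
  let P : Subsemigroup (L2 Γ H →L[ℂ] L2 Γ H) :=
    { carrier := {x | ∃ c ∈ C.1, ∃ s : Γ, regularHom α ρ c * translation s = x}
      mul_mem' := by
        rintro _ _ ⟨c, hc, s, rfl⟩ ⟨d, hd, t, rfl⟩
        exact ⟨_, mul_mem hc (hC s d hd), s * t,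
          (regularHom_mul_translation_mul α ρ c d s t).symm⟩ }
  have star_subset : star (P : Set (L2 Γ H →L[ℂ] L2 Γ H)) ⊆ P := by
    rintro x ⟨c, hc, s, h⟩
    exact ⟨_, hC s⁻¹ _ (star_mem hc), s⁻¹, by
      rw [← star_regularHom_mul_translation, h, star_star]⟩
  let N : Submodule ℂ (Γ →₀ A) :=
    { carrier := {b | ∀ s, b s ∈ C.1}
      zero_mem' := fun _ => zero_mem C.1
      add_mem' := fun hb hc s => add_mem (hb s) (hc s)
      smul_mem' := fun c b hb s => SMulMemClass.smul_mem c (hb s) }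
  suffices adjoin_le : (NonUnitalStarAlgebra.adjoin ℂ (P : Set _)).toSubmodule ≤
      N.map (crossedSum α ρ) from adjoin_le hx
  rw [NonUnitalStarAlgebra.adjoin_eq_span, Submodule.span_le]
  intro x hx
  obtain ⟨c, hc, s, rfl⟩ := Subsemigroup.closure_le.2 (Set.union_subset le_rfl star_subset) hx
  refine ⟨Finsupp.single s c, fun t => ?_, crossedSum_single α ρ s c⟩
  rw [Finsupp.single_apply]
  split_ifs
  · exact hc
  · exact zero_mem C.1

theorem exists_crossedSum_near (hC : ∀ s, ∀ c ∈ C.1, α s c ∈ C.1) {x : L2 Γ H →L[ℂ] L2 Γ H}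
    (hx : x ∈ (crossedProduct α ρ C).1) {ε : ℝ} (hε : 0 < ε) :
    ∃ b : Γ →₀ A, (∀ s, b s ∈ C.1) ∧ ‖x - crossedSum α ρ b‖ < ε := by
  have hx' : x ∈ closure ((NonUnitalStarAlgebra.adjoin ℂ
      {x | ∃ c ∈ C.1, ∃ s : Γ, regularHom α ρ c * translation s = x} :
      NonUnitalStarSubalgebra ℂ _) : Set (L2 Γ H →L[ℂ] L2 Γ H)) := hx
  obtain ⟨y, hy, hxy⟩ := Metric.mem_closure_iff.1 hx' ε hε
  obtain ⟨b, hb, rfl⟩ := exists_crossedSum_eq hC hy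
  exact ⟨b, hb, by rwa [← dist_eq_norm]⟩

theorem mem_of_regularHom_mem_crossedProduct (hρ : Function.Injective ρ)
    (hC : ∀ s, ∀ c ∈ C.1, α s c ∈ C.1) {a : A}
    (ha : regularHom α ρ a ∈ (crossedProduct α ρ C).1) : a ∈ C.1 := by
  suffices a ∈ closure (C.1 : Set A) by rwa [C.2.closure_eq] at this
  refine Metric.mem_closure_iff.2 fun ε hε => ?_
  obtain ⟨b, hb, hab⟩ := exists_crossedSum_near hC ha hε
  have sub_eq : regularHom α ρ a - crossedSum α ρ b = crossedSum α ρ (Finsupp.single 1 a - b) := by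
    rw [map_sub, crossedSum_single, translation_one, mul_one]
  have coeff_le := norm_coeff_le α hρ (Finsupp.single 1 a - b) 1
  rw [Finsupp.sub_apply, Finsupp.single_eq_same, ← sub_eq] at coeff_le
  refine ⟨b 1, hb 1, ?_⟩
  rw [dist_eq_norm]
  exact coeff_le.trans_lt hab

end CrossedProduct

/-! ### The approximation property -/

section Predual

variable {Γ : Type*} [Group Γ] {q : cbMultipliers Γ →ₗ[ℂ] ℂ}

theorem IsPredualFunctional.of_approx
    (h : ∀ ε > 0, ∃ q' : cbMultipliers Γ →ₗ[ℂ] ℂ, IsPredualFunctional q' ∧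
      ∀ (φ : cbMultipliers Γ) (C : ℝ), IsCBMultiplierWith φ.1 C → ‖q φ - q' φ‖ ≤ ε * C) :
    IsPredualFunctional q := by
  intro ε hε
  obtain ⟨q', hq', hqq'⟩ := h (ε / 2) (half_pos hε)
  obtain ⟨f, hf, hfq⟩ := hq' (ε / 2) (half_pos hε)
  refine ⟨f, hf, fun φ C hφ => ?_⟩
  calc ‖q φ - ∑' s, f s * φ.1 s‖ ≤ ‖q φ - q' φ‖ + ‖q' φ - ∑' s, f s * φ.1 s‖ :=
        norm_sub_le_norm_sub_add_norm_sub _ _ _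
    _ ≤ ε / 2 * C + ε / 2 * C := add_le_add (hqq' φ C hφ) (hfq φ C hφ)
    _ = ε * C := by ring

theorem HasAP.apply_cbOne_eq_zero (hΓ : HasAP Γ) (hq : IsPredualFunctional q)
    (hfin : ∀ φ : cbMultipliers Γ, (Function.support φ.1).Finite → q φ = 0) :
    q (cbOne Γ) = 0 := by
  obtain ⟨l, hl, hlfin, hlq⟩ := hΓ
  exact tendsto_nhds_unique (hlq q hq)
    (tendsto_const_nhds.congr' (hlfin.mono fun φ hφ => (hfin φ hφ).symm))

end Predual

theorem exists_tendsto_of_norm_sub_le {E F : Type*} [SeminormedAddCommGroup E]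
    [SeminormedAddCommGroup F] [CompleteSpace F] {x : ℕ → E} (hx : CauchySeq x) {y : ℕ → F} {C : ℝ}
    (h : ∀ m n, ‖y m - y n‖ ≤ C * ‖x m - x n‖) : ∃ z, Tendsto y atTop (𝓝 z) := by
  refine cauchySeq_tendsto_of_complete (cauchySeq_iff_tendsto_dist_atTop_0.2 ?_)
  refine squeeze_zero (fun _ => dist_nonneg) (fun i => ?_)
    (by simpa using (cauchySeq_iff_tendsto_dist_atTop_0.1 hx).const_mul C)
  simpa only [dist_eq_norm] using h i.1 i.2

theorem exists_dual_of_notMem {E : Type*} [NormedAddCommGroup E] [NormedSpace ℂ E]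
    {S : Submodule ℂ E} (hS : IsClosed (S : Set E)) {a : E} (ha : a ∉ S) :
    ∃ ω : E →L[ℂ] ℂ, ω a ≠ 0 ∧ ∀ x ∈ S, ω x = 0 := by
  have : IsClosed (S : Set E) := hS
  have mkQ_ne : S.mkQ a ≠ 0 := fun h => ha ((Submodule.Quotient.mk_eq_zero S).1 h)
  obtain ⟨g, -, hg⟩ := exists_dual_vector ℂ (S.mkQ a) (norm_ne_zero_iff.2 mkQ_ne)
  refine ⟨g ∘L S.mkQL, ?_, fun x hx => ?_⟩
  · change g (S.mkQ a) ≠ 0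
    rw [hg]
    simpa using mkQ_ne
  · change g (S.mkQ x) = 0
    rw [show S.mkQ x = 0 from (Submodule.Quotient.mk_eq_zero S).2 hx, map_zero]

section Approximation

variable {Γ A H : Type*} [Group Γ] [NonUnitalCStarAlgebra A] [NormedAddCommGroup H]
  [InnerProductSpace ℂ H] [CompleteSpace H] (α : Γ →* (A →⋆ₙₐ[ℂ] A))
  (ρ : A →⋆ₙₐ[ℂ] (H →L[ℂ] H))

/-- The functional `φ ↦ ω (∑ φ(s) b_s λ_s)` on the completely bounded multipliers. -/
def coeffFunctional (ω : (L2 Γ H →L[ℂ] L2 Γ H) →L[ℂ] ℂ) (b : Γ →₀ A) :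
    cbMultipliers Γ →ₗ[ℂ] ℂ where
  toFun φ := ω (weightedSum α ρ φ.1 b)
  map_add' φ ψ := by
    rw [← map_add]
    congr 1
    simp [weightedSum_eq, Finsupp.sum, add_smul, Finset.sum_add_distrib]
  map_smul' c φ := by
    rw [RingHom.id_apply, ← map_smul]
    congr 1
    simp [weightedSum_eq, Finsupp.sum, mul_smul, Finset.smul_sum]

variable {α ρ} (ω : (L2 Γ H →L[ℂ] L2 Γ H) →L[ℂ] ℂ)

theorem coeffFunctional_eq_tsum (b : Γ →₀ A) (φ : cbMultipliers Γ) :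
    coeffFunctional α ρ ω b φ = ∑' s, ω (regularHom α ρ (b s) * translation s) * φ.1 s := by
  change ω (weightedSum α ρ φ.1 b) = _
  rw [weightedSum_eq, Finsupp.sum, map_sum, tsum_eq_sum (s := b.support)]
  · simp only [map_smul, smul_eq_mul, mul_comm]
  · intro s hs
    rw [Finsupp.notMem_support_iff.1 hs, map_zero, zero_mul, map_zero, zero_mul]

theorem norm_coeffFunctional_sub_le (b c : Γ →₀ A) (φ : cbMultipliers Γ) {C : ℝ}
    (hφ : IsCBMultiplierWith φ.1 C) :
    ‖coeffFunctional α ρ ω b φ - coeffFunctional α ρ ω c φ‖ ≤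
      ‖ω‖ * C * ‖crossedSum α ρ b - crossedSum α ρ c‖ := by
  change ‖ω (weightedSum α ρ φ.1 b) - ω (weightedSum α ρ φ.1 c)‖ ≤ _
  rw [← map_sub, ← map_sub, ← map_sub, mul_assoc]
  exact (ω.le_opNorm _).trans
    (mul_le_mul_of_nonneg_left (hφ.norm_weightedSum_le α ρ _) (norm_nonneg ω))

theorem isPredualFunctional_coeffFunctional (b : Γ →₀ A) :
    IsPredualFunctional (coeffFunctional α ρ ω b) := by
  intro ε hε
  refine ⟨fun s => ω (regularHom α ρ (b s) * translation s), ?_, fun φ C hφ => ?_⟩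
  · refine summable_of_ne_finset_zero (s := b.support) fun s hs => ?_
    simp only [Finsupp.notMem_support_iff.1 hs, map_zero, zero_mul, norm_zero]
  · rw [coeffFunctional_eq_tsum, sub_self, norm_zero]
    exact mul_nonneg hε.le hφ.nonneg

theorem exists_isPredualFunctional_tendsto {a : L2 Γ H →L[ℂ] L2 Γ H} {b : ℕ → Γ →₀ A}
    (hb : Tendsto (fun n => crossedSum α ρ (b n)) atTop (𝓝 a)) :
    ∃ q : cbMultipliers Γ →ₗ[ℂ] ℂ, IsPredualFunctional q ∧
      ∀ φ, Tendsto (fun n => coeffFunctional α ρ ω (b n) φ) atTop (𝓝 (q φ)) := by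
  have exists_limit (φ : cbMultipliers Γ) :
      ∃ z, Tendsto (fun n => coeffFunctional α ρ ω (b n) φ) atTop (𝓝 z) := by
    obtain ⟨C, hφ⟩ := φ.2
    exact exists_tendsto_of_norm_sub_le hb.cauchySeq fun m n =>
      norm_coeffFunctional_sub_le ω (b m) (b n) φ hφ
  choose q₀ hq₀ using exists_limit
  let q : cbMultipliers Γ →ₗ[ℂ] ℂ :=
    linearMapOfTendsto q₀ (fun n => coeffFunctional α ρ ω (b n)) (tendsto_pi_nhds.2 hq₀)
  have hq : ∀ φ, Tendsto (fun n => coeffFunctional α ρ ω (b n) φ) atTop (𝓝 (q φ)) := hq₀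
  have norm_sub_le (n : ℕ) (φ : cbMultipliers Γ) (C : ℝ) (hφ : IsCBMultiplierWith φ.1 C) :
      ‖q φ - coeffFunctional α ρ ω (b n) φ‖ ≤ ‖ω‖ * C * ‖a - crossedSum α ρ (b n)‖ :=
    le_of_tendsto_of_tendsto' ((hq φ).sub_const _).norm ((hb.sub_const _).norm.const_mul _)
      fun m => norm_coeffFunctional_sub_le ω (b m) (b n) φ hφ
  have error_tendsto : Tendsto (fun n => ‖ω‖ * ‖a - crossedSum α ρ (b n)‖) atTop (𝓝 0) := by
    simpa using ((tendsto_const_nhds (x := a)).sub hb).norm.const_mul ‖ω‖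
  refine ⟨q, .of_approx fun ε hε => ?_, hq⟩
  obtain ⟨n, hn⟩ := (error_tendsto.eventually (gt_mem_nhds hε)).exists
  refine ⟨coeffFunctional α ρ ω (b n), isPredualFunctional_coeffFunctional ω (b n),
    fun φ C hφ => ?_⟩
  calc ‖q φ - coeffFunctional α ρ ω (b n) φ‖ ≤ ‖ω‖ * C * ‖a - crossedSum α ρ (b n)‖ :=
        norm_sub_le n φ C hφ
    _ = ‖ω‖ * ‖a - crossedSum α ρ (b n)‖ * C := by ring
    _ ≤ ε * C := mul_le_mul_of_nonneg_right hn.le hφ.nonneg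

theorem HasAP.mem_crossedProduct (hΓ : HasAP Γ) {D : CStarSubalgebra A}
    {a : L2 Γ H →L[ℂ] L2 Γ H} {b : ℕ → Γ →₀ A}
    (hb : Tendsto (fun n => crossedSum α ρ (b n)) atTop (𝓝 a))
    {e : Γ → A} (he : ∀ s, Tendsto (fun n => b n s) atTop (𝓝 (e s)))
    (heD : ∀ s, e s ∈ D.1) : a ∈ (crossedProduct α ρ D).1 := by
  by_contra ha
  obtain ⟨ω, hωa, hω⟩ := exists_dual_of_notMem
    (S := (crossedProduct α ρ D).1.toNonUnitalSubalgebra.toSubmodule) (crossedProduct α ρ D).2 ha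
  obtain ⟨q, hq, hlim⟩ := exists_isPredualFunctional_tendsto ω hb
  have apply_cbOne : q (cbOne Γ) = ω a :=
    tendsto_nhds_unique (hlim (cbOne Γ)) ((ω.continuous.tendsto a).comp hb)
  refine hωa (apply_cbOne ▸ hΓ.apply_cbOne_eq_zero hq fun φ hφ => ?_)
  have apply_eq_sum : q φ =
      ∑ s ∈ hφ.toFinset, ω (regularHom α ρ (e s) * translation s) * φ.1 s := by
    refine tendsto_nhds_unique (hlim φ) (Tendsto.congr (fun n => ?_) (tendsto_finsetSum _ fun s _ =>
      ((ω.continuous.tendsto _).comp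
        ((((continuous_regularHom α ρ).tendsto _).comp (he s)).mul_const _)).mul_const _))
    rw [coeffFunctional_eq_tsum, tsum_eq_sum (s := hφ.toFinset)]
    · rfl
    · intro s hs
      rw [Set.Finite.mem_toFinset, Function.notMem_support] at hs
      rw [hs, mul_zero]
  rw [apply_eq_sum]
  refine Finset.sum_eq_zero fun s _ => ?_
  rw [hω _ (regularHom_mul_translation_mem_crossedProduct (heD s) s), zero_mul]

end Approximation

/-! ### Freely localizing central subalgebras -/

open scoped WithCStarModule in
theorem norm_sum_star_mul_mul_le {A ι : Type*} [NonUnitalCStarAlgebra A] [PartialOrder A]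
    [StarOrderedRing A] [Fintype ι] (a : ι → A) (ha : ‖∑ i, star (a i) * a i‖ ≤ 1) (T : A) :
    ‖∑ i, star (a i) * T * a i‖ ≤ ‖T‖ := by
  let x : C⋆ᵐᵒᵈ(A, ι → A) := (WithCStarModule.equiv A (ι → A)).symm fun i => star (a i)
  let y : C⋆ᵐᵒᵈ(A, ι → A) := (WithCStarModule.equiv A (ι → A)).symm fun i => star (a i) * T
  have inner_eq : inner A x y = ∑ i, star (a i) * T * a i := by
    simp [x, y, WithCStarModule.pi_inner, WithCStarModule.inner_def]
  have norm_x : ‖x‖ ≤ 1 := by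
    rw [← sq_le_one_iff₀ (norm_nonneg _), WithCStarModule.pi_norm_sq]
    simpa [x, WithCStarModule.inner_def] using ha
  have norm_y : ‖y‖ ≤ ‖T‖ := by
    rw [← sq_le_sq₀ (norm_nonneg _) (norm_nonneg _), WithCStarModule.pi_norm_sq]
    have inner_y (i : ι) : inner A (y i) (y i) = star (a i) * (T * star T) * a i := by
      simp [y, WithCStarModule.inner_def, mul_assoc]
    simp only [inner_y]
    calc ‖∑ i, star (a i) * (T * star T) * a i‖
        ≤ ‖‖T * star T‖ • ∑ i, star (a i) * a i‖ := by
          refine CStarAlgebra.norm_le_norm_of_nonneg_of_le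
            (Finset.sum_nonneg fun i _ => star_left_conjugate_nonneg (mul_star_self_nonneg T) _) ?_
          rw [Finset.smul_sum]
          exact Finset.sum_le_sum fun i _ => CStarAlgebra.star_left_conjugate_le_norm_smul
      _ ≤ ‖T‖ ^ 2 := by
          rw [norm_smul, norm_norm, CStarRing.norm_self_mul_star, ← sq]
          exact mul_le_of_le_one_right (sq_nonneg _) ha
  rw [← inner_eq]
  exact (CStarModule.norm_inner_le _).trans
    ((mul_le_of_le_one_left (norm_nonneg _) norm_x).trans norm_y)

section Localizing

variable {Γ A H : Type*} [Group Γ] [NonUnitalCStarAlgebra A] [NormedAddCommGroup H]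
  [InnerProductSpace ℂ H] [CompleteSpace H]

/-- A finite family of self-adjoint elements with `∑ p_i² ≤ 1`, each of them orthogonal to its
translates by the nontrivial elements of `F`. -/
structure IsWandering (α : Γ →* (A →⋆ₙₐ[ℂ] A)) (F : Finset Γ) {n : ℕ} (p : Fin n → A) : Prop where
  isSelfAdjoint : ∀ i, IsSelfAdjoint (p i)
  norm_sum_le : ‖∑ i, p i * p i‖ ≤ 1
  mul_eq_zero : ∀ i, ∀ s ∈ F, s ≠ 1 → p i * α s (p i) = 0

/-- A central subalgebra of `A` on which `Γ` acts freely and which contains an approximate unit of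
`A`, in the quantitative form that the sums `∑ p_i²` of wandering families are approximate units.
The model is `C₀(X) ⊆ C₀(Y)`, for a proper factor map `Y → X` onto a free `Γ`-space. -/
structure IsFreelyLocalizing (α : Γ →* (A →⋆ₙₐ[ℂ] A)) (D : CStarSubalgebra A) : Prop where
  commute : ∀ p ∈ D.1, ∀ a, Commute p a
  exists_isWandering : ∀ (F : Finset Γ) (a : A) (ε : ℝ), 0 < ε → ∃ (n : ℕ) (p : Fin n → A),
    IsWandering α F p ∧ (∀ i, p i ∈ D.1) ∧ ‖a * ∑ i, p i * p i - a‖ ≤ ε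

variable {α : Γ →* (A →⋆ₙₐ[ℂ] A)} {ρ : A →⋆ₙₐ[ℂ] (H →L[ℂ] H)} {D : CStarSubalgebra A}
  {n : ℕ} {p : Fin n → A}

variable (α ρ) in
/-- The map `x ↦ ∑ p_i x λ_s⁻¹ p_i`, which isolates the coefficient of `λ_s`. -/
def localCoeff (p : Fin n → A) (s : Γ) :
    (L2 Γ H →L[ℂ] L2 Γ H) →ₗ[ℂ] (L2 Γ H →L[ℂ] L2 Γ H) :=
  ∑ i, LinearMap.mulLeftRight ℂ
    (regularHom α ρ (p i), translation s⁻¹ * regularHom α ρ (p i))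

theorem localCoeff_apply (s : Γ) (x : L2 Γ H →L[ℂ] L2 Γ H) :
    localCoeff α ρ p s x =
      ∑ i, regularHom α ρ (p i) * (x * translation s⁻¹) * regularHom α ρ (p i) := by
  simp [localCoeff, mul_assoc]

theorem IsWandering.norm_localCoeff_le {F : Finset Γ} (hp : IsWandering α F p) (s : Γ)
    (x : L2 Γ H →L[ℂ] L2 Γ H) : ‖localCoeff α ρ p s x‖ ≤ ‖x‖ := by
  have star_eq (i : Fin n) : star (regularHom α ρ (p i)) = regularHom α ρ (p i) :=
    ((hp.isSelfAdjoint i).map (regularHom α ρ)).star_eq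
  have norm_sum_le : ‖∑ i, star (regularHom α ρ (p i)) * regularHom α ρ (p i)‖ ≤ 1 := by
    simp only [star_eq, ← map_mul, ← map_sum]
    exact (norm_regularHom_le α ρ _).trans hp.norm_sum_le
  have norm_le := norm_sum_star_mul_mul_le _ norm_sum_le (x * translation s⁻¹)
  simp only [star_eq] at norm_le
  rwa [localCoeff_apply, ← norm_mul_translation x s⁻¹]

open Classical in
theorem IsWandering.localCoeff_single {F : Finset Γ} (hp : IsWandering α F p)
    (hcomm : ∀ i a, Commute (p i) a) {s t : Γ} (ht : t * s⁻¹ ∈ F) (a : A) :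
    localCoeff α ρ p s (regularHom α ρ a * translation t) =
      if t = s then regularHom α ρ (a * ∑ i, p i * p i) else 0 := by
  have conjugate_eq (i : Fin n) :
      regularHom α ρ (p i) * (regularHom α ρ a * translation t * translation s⁻¹) *
          regularHom α ρ (p i) =
        regularHom α ρ (a * (p i * α (t * s⁻¹) (p i))) * translation (t * s⁻¹) := by
    rw [mul_assoc (regularHom α ρ a), translation_mul, mul_assoc, mul_assoc,
      translation_mul_regularHom, ← mul_assoc, ← mul_assoc, ← map_mul, ← map_mul,
      (hcomm i a).eq, mul_assoc]
  simp only [localCoeff_apply, conjugate_eq]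
  split_ifs with h
  · subst h
    rw [Finset.mul_sum, map_sum]
    refine Finset.sum_congr rfl fun i _ => ?_
    rw [mul_inv_cancel, translation_one, mul_one, map_one]
    rfl
  · refine Finset.sum_eq_zero fun i _ => ?_
    rw [hp.mul_eq_zero i _ ht (by rwa [Ne, mul_inv_eq_one]), mul_zero, map_zero, zero_mul]

theorem IsWandering.localCoeff_crossedSum {F : Finset Γ} (hp : IsWandering α F p)
    (hcomm : ∀ i a, Commute (p i) a) {b : Γ →₀ A} {s : Γ} (hF : ∀ t ∈ b.support, t * s⁻¹ ∈ F) :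
    localCoeff α ρ p s (crossedSum α ρ b) = regularHom α ρ (b s * ∑ i, p i * p i) := by
  classical
  rw [crossedSum_eq, Finsupp.sum, map_sum,
    Finset.sum_congr rfl fun t ht => hp.localCoeff_single hcomm (hF t ht) (b t), Finset.sum_ite_eq']
  split_ifs with hs
  · rfl
  · rw [Finsupp.notMem_support_iff.1 hs, zero_mul, map_zero]

variable {B : CStarSubalgebra (L2 Γ H →L[ℂ] L2 Γ H)}

theorem translation_inv_mul_regularHom_mem (hB : crossedProduct α ρ D ≤ B) {c : A} (hc : c ∈ D.1)
    (s : Γ) : translation s⁻¹ * regularHom α ρ c ∈ B.1 := by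
  have star_mem := star_mem (hB (regularHom_mul_translation_mem_crossedProduct (star_mem hc) s))
  rwa [star_mul, star_translation, map_star, star_star] at star_mem

theorem localCoeff_mem (hB : crossedProduct α ρ D ≤ B) (hp : ∀ i, p i ∈ D.1) (s : Γ)
    {x : L2 Γ H →L[ℂ] L2 Γ H} (hx : x ∈ B.1) : localCoeff α ρ p s x ∈ B.1 := by
  rw [localCoeff_apply]
  refine sum_mem fun i _ => ?_
  rw [mul_assoc, mul_assoc]
  exact mul_mem (hB (regularHom_mem_crossedProduct (hp i)))
    (mul_mem hx (translation_inv_mul_regularHom_mem hB (hp i) s))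

theorem IsFreelyLocalizing.exists_mem_near_coeff (hD : IsFreelyLocalizing α D)
    (hB : crossedProduct α ρ D ≤ B) {x : L2 Γ H →L[ℂ] L2 Γ H} (hx : x ∈ B.1) {b : Γ →₀ A}
    {ε : ℝ} (hε : 0 < ε) (hxb : ‖x - crossedSum α ρ b‖ ≤ ε) (s : Γ) :
    ∃ y ∈ B.1, ‖y - regularHom α ρ (b s)‖ ≤ ε + ε := by
  classical
  obtain ⟨n, p, hp, hpD, hbp⟩ := hD.exists_isWandering (b.support.image (· * s⁻¹)) (b s) ε hε
  have localCoeff_sub : localCoeff α ρ p s x - regularHom α ρ (b s) =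
      localCoeff α ρ p s (x - crossedSum α ρ b) +
        regularHom α ρ (b s * ∑ i, p i * p i - b s) := by
    rw [map_sub, map_sub, hp.localCoeff_crossedSum (fun i => hD.commute _ (hpD i)) fun t ht =>
      Finset.mem_image_of_mem _ ht]
    abel
  refine ⟨localCoeff α ρ p s x, localCoeff_mem hB hpD s hx, ?_⟩
  rw [localCoeff_sub]
  exact norm_add_le_of_le ((hp.norm_localCoeff_le s _).trans hxb)
    ((norm_regularHom_le α ρ _).trans hbp)

theorem IsFreelyLocalizing.regularHom_mul_translation_mem (hD : IsFreelyLocalizing α D) {a : A}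
    {s : Γ} (h : ∀ c ∈ D.1, regularHom α ρ (a * c) * translation s ∈ B.1) :
    regularHom α ρ a * translation s ∈ B.1 := by
  suffices regularHom α ρ a * translation s ∈ closure (B.1 : Set _) by
    rwa [B.2.closure_eq] at this
  refine Metric.mem_closure_iff.2 fun ε hε => ?_
  obtain ⟨n, p, -, hpD, hap⟩ := hD.exists_isWandering ∅ a (ε / 2) (half_pos hε)
  refine ⟨_, h (∑ i, p i * p i) (sum_mem fun i _ => mul_mem (hpD i) (hpD i)), ?_⟩
  rw [dist_eq_norm', ← sub_mul, ← map_sub, norm_mul_translation]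
  exact ((norm_regularHom_le α ρ _).trans hap).trans_lt (half_lt_self hε)

variable (α ρ) in
/-- The elements of `A` whose regular representation lies in a given algebra of operators
on `ℓ²(Γ, H)`. -/
def coefficientAlgebra (B : CStarSubalgebra (L2 Γ H →L[ℂ] L2 Γ H)) : CStarSubalgebra A :=
  ⟨B.1.comap (regularHom α ρ), B.2.preimage (continuous_regularHom α ρ)⟩

theorem mem_coefficientAlgebra {a : A} :
    a ∈ (coefficientAlgebra α ρ B).1 ↔ regularHom α ρ a ∈ B.1 := Iff.rfl

theorem IsFreelyLocalizing.crossedProduct_coefficientAlgebra_le (hD : IsFreelyLocalizing α D)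
    (hB : crossedProduct α ρ D ≤ B) : crossedProduct α ρ (coefficientAlgebra α ρ B) ≤ B := by
  refine crossedProduct_le.2 fun a ha s => hD.regularHom_mul_translation_mem fun c hc => ?_
  rw [map_mul, mul_assoc]
  exact mul_mem ha (hB (regularHom_mul_translation_mem_crossedProduct hc s))

/-- The `Γ`-invariant C*-subalgebras of `A` containing `D`. -/
def invariantExtensions (α : Γ →* (A →⋆ₙₐ[ℂ] A)) (D : CStarSubalgebra A) :
    Set (CStarSubalgebra A) :=
  {C | D ≤ C ∧ ∀ s, ∀ c ∈ C.1, α s c ∈ C.1}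

theorem IsFreelyLocalizing.coefficientAlgebra_mem (hD : IsFreelyLocalizing α D)
    (hB : crossedProduct α ρ D ≤ B) : coefficientAlgebra α ρ B ∈ invariantExtensions α D := by
  refine ⟨fun c hc => hB (regularHom_mem_crossedProduct hc), fun s a ha => ?_⟩
  have mul_translation_mem : regularHom α ρ (α s a) * translation s ∈ B.1 := by
    refine hD.regularHom_mul_translation_mem fun c hc => ?_
    rw [← (hD.commute c hc _).eq, map_mul, mul_assoc, ← translation_mul_regularHom, ← mul_assoc]
    exact mul_mem (hB (regularHom_mul_translation_mem_crossedProduct hc s)) ha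
  suffices regularHom α ρ (α s a) * translation 1 ∈ B.1 by
    rwa [translation_one, mul_one] at this
  refine hD.regularHom_mul_translation_mem fun c hc => ?_
  have mem := mul_mem mul_translation_mem (translation_inv_mul_regularHom_mem hB hc s)
  rwa [mul_assoc, ← mul_assoc (translation s), translation_mul, mul_inv_cancel, translation_one,
    one_mul, ← map_mul, ← mul_one (regularHom α ρ (α s a * c)), ← translation_one] at mem

theorem IsFreelyLocalizing.mem_coefficientAlgebra_of_tendsto (hD : IsFreelyLocalizing α D)
    (hB : crossedProduct α ρ D ≤ B) {x : L2 Γ H →L[ℂ] L2 Γ H} (hx : x ∈ B.1) {b : ℕ → Γ →₀ A}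
    (hb : Tendsto (fun n => crossedSum α ρ (b n)) atTop (𝓝 x)) {s : Γ} {a : A}
    (ha : Tendsto (fun n => b n s) atTop (𝓝 a)) : a ∈ (coefficientAlgebra α ρ B).1 := by
  rw [mem_coefficientAlgebra]
  suffices regularHom α ρ a ∈ closure (B.1 : Set _) by rwa [B.2.closure_eq] at this
  refine Metric.mem_closure_iff.2 fun ε hε => ?_
  have coeff_tendsto := ((continuous_regularHom α ρ).tendsto a).comp ha
  obtain ⟨n, hxb, hab⟩ := ((Metric.tendsto_nhds.1 hb (ε / 4) (by positivity)).and
    (Metric.tendsto_nhds.1 coeff_tendsto (ε / 4) (by positivity))).exists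
  obtain ⟨y, hy, hyb⟩ := hD.exists_mem_near_coeff hB hx (by positivity : 0 < ε / 4)
    (by rw [← dist_eq_norm']; exact hxb.le) s
  refine ⟨y, hy, ?_⟩
  rw [← dist_eq_norm'] at hyb
  have triangle := dist_triangle (regularHom α ρ a) (regularHom α ρ (b n s)) y
  rw [Function.comp_apply, dist_comm] at hab
  linarith

variable {E : CStarSubalgebra A}

theorem exists_tendsto_crossedSum (hE : ∀ s, ∀ c ∈ E.1, α s c ∈ E.1) {x : L2 Γ H →L[ℂ] L2 Γ H}
    (hx : x ∈ (crossedProduct α ρ E).1) :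
    ∃ b : ℕ → Γ →₀ A, Tendsto (fun n => crossedSum α ρ (b n)) atTop (𝓝 x) := by
  choose b _ hb using fun n : ℕ =>
    exists_crossedSum_near hE hx (Nat.one_div_pos_of_nat (α := ℝ) (n := n))
  refine ⟨b, tendsto_iff_norm_sub_tendsto_zero.2 (squeeze_zero (fun _ => norm_nonneg _)
    (fun n => ?_) (tendsto_one_div_add_atTop_nhds_zero_nat (𝕜 := ℝ)))⟩
  rw [norm_sub_rev]
  exact (hb n).le

theorem HasAP.crossedProduct_coefficientAlgebra (hΓ : HasAP Γ) (hD : IsFreelyLocalizing α D)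
    (hρ : Function.Injective ρ) (hE : ∀ s, ∀ c ∈ E.1, α s c ∈ E.1)
    (hDB : crossedProduct α ρ D ≤ B) (hBE : B ≤ crossedProduct α ρ E) :
    crossedProduct α ρ (coefficientAlgebra α ρ B) = B := by
  refine le_antisymm (hD.crossedProduct_coefficientAlgebra_le hDB) fun x hx => ?_
  obtain ⟨b, hb⟩ := exists_tendsto_crossedSum hE (hBE hx)
  have exists_coeff (s : Γ) : ∃ a, Tendsto (fun n => b n s) atTop (𝓝 a) :=
    exists_tendsto_of_norm_sub_le (C := 1) hb.cauchySeq fun m n => by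
      rw [one_mul, ← map_sub, ← Finsupp.sub_apply]
      exact norm_coeff_le α hρ _ s
  choose e he using exists_coeff
  exact hΓ.mem_crossedProduct hb he fun s => hD.mem_coefficientAlgebra_of_tendsto hDB hx hb (he s)

/-- `C ↦ C ⋊ Γ`, from the invariant C*-subalgebras of `A` containing `D` to the C*-algebras
between `D ⋊ Γ` and `A ⋊ Γ`. The algebra `E` is all of `A`. -/
def crossedProductOrderIso (hΓ : HasAP Γ) (hρ : Function.Injective ρ)
    (hD : IsFreelyLocalizing α D) (hE : ∀ a, a ∈ E.1) :
    invariantExtensions α D ≃o Set.Icc (crossedProduct α ρ D) (crossedProduct α ρ E) where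
  toFun C :=
    ⟨crossedProduct α ρ C.1, crossedProduct_mono C.2.1, crossedProduct_mono fun a _ => hE a⟩
  invFun B := ⟨coefficientAlgebra α ρ B.1, hD.coefficientAlgebra_mem B.2.1⟩
  left_inv C := Subtype.ext <| Subtype.ext <| SetLike.ext fun _ =>
    ⟨mem_of_regularHom_mem_crossedProduct hρ C.2.2, regularHom_mem_crossedProduct⟩
  right_inv B := Subtype.ext <|
    hΓ.crossedProduct_coefficientAlgebra hD hρ (fun _ _ _ => hE _) B.2.1 B.2.2
  map_rel_iff' {_ C} := ⟨fun h _ hc =>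
    mem_of_regularHom_mem_crossedProduct hρ C.2.2 (h (regularHom_mem_crossedProduct hc)),
    crossedProduct_mono⟩

end Localizing

/-! ### Free actions on locally compact spaces -/

section ZeroAtInfty

variable {Γ X Y Z ι : Type*} [Group Γ] [TopologicalSpace X] [TopologicalSpace Y]
  [TopologicalSpace Z] [MulAction Γ Y] [ContinuousConstSMul Γ Y] [MulAction Γ Z]
  [ContinuousConstSMul Γ Z]

variable (Γ Y) in
/-- The action of `Γ` on `C₀(Y)`, as a homomorphism into the *-endomorphisms of `C₀(Y)`. -/
def functionActionHom : Γ →* (C₀(Y, ℂ) →⋆ₙₐ[ℂ] C₀(Y, ℂ)) where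
  toFun := functionAction Γ Y
  map_one' := by
    ext f y
    change f ((1 : Γ)⁻¹ • y) = f y
    rw [inv_one, one_smul]
  map_mul' s t := by
    ext f y
    change f ((s * t)⁻¹ • y) = f (t⁻¹ • s⁻¹ • y)
    rw [mul_inv_rev, mul_smul]

theorem multiplicationRep_injective : Function.Injective (multiplicationRep Y) := by
  classical
  intro f g h
  ext y
  have single_eq := congrArg (fun T : L2 Y ℂ →L[ℂ] L2 Y ℂ => T (lp.single 2 y 1) y) h
  simpa [multiplicationRep] using single_eq

theorem factorCrossedProduct_eq (g : CocompactMap Y Z) (hg : Function.Surjective g)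
    (map_smul : ∀ (s : Γ) (y : Y), g (s • y) = s • g y) :
    factorCrossedProduct Γ g =
      crossedProduct (functionActionHom Γ Y) (multiplicationRep Y) (functionAlgebra g hg) := by
  have regularRep_eq (f : C₀(Z, ℂ)) :
      regularRep (functionAction Γ Z) ((multiplicationRep Y).comp (pullback g)) f =
        regularHom (functionActionHom Γ Y) (multiplicationRep Y) (pullback g f) := by
    ext ξ t y
    change f (t⁻¹⁻¹ • g y) * ξ t y = f (g (t⁻¹⁻¹ • y)) * ξ t y
    rw [map_smul]
  rw [factorCrossedProduct, reducedCrossedProduct, crossedProduct]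
  congr 1
  ext x
  constructor
  · rintro ⟨⟨f, s⟩, rfl⟩
    exact ⟨pullback g f, ⟨f, rfl⟩, s, congrArg (· * translation s) (regularRep_eq f).symm⟩
  · rintro ⟨_, ⟨f, rfl⟩, s, rfl⟩
    exact ⟨(f, s), congrArg (· * translation s) (regularRep_eq f)⟩

theorem norm_zeroAtInfty_le {f : C₀(Y, ℂ)} {r : ℝ} (hr : 0 ≤ r) (h : ∀ y, ‖f y‖ ≤ r) :
    ‖f‖ ≤ r := by
  rw [← ZeroAtInftyContinuousMap.norm_toBCF_eq_norm]
  exact (BoundedContinuousFunction.norm_le hr).2 h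

theorem zeroAtInfty_sum_apply (s : Finset ι) (f : ι → C₀(Y, ℂ)) (y : Y) :
    (∑ i ∈ s, f i) y = ∑ i ∈ s, f i y :=
  map_sum ({ toFun := fun f => f y, map_zero' := rfl, map_add' := fun _ _ => rfl } :
    C₀(Y, ℂ) →+ ℂ) f s

theorem exists_isSelfAdjoint_mul_self_eq {f : C(X, ℝ)} (hf : HasCompactSupport f)
    (hf₀ : ∀ x, 0 ≤ f x) :
    ∃ h : C₀(X, ℂ), IsSelfAdjoint h ∧ ∀ x, h x * h x = (f x : ℂ) := by
  have hsqrt : HasCompactSupport fun x => (√(f x) : ℂ) :=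
    hf.comp_left (g := fun r : ℝ => (√r : ℂ)) (by simp)
  refine ⟨⟨⟨fun x => (√(f x) : ℂ), by fun_prop⟩, hsqrt.is_zero_at_infty⟩, ?_, fun x => ?_⟩
  · ext x
    exact Complex.conj_ofReal _
  · change (√(f x) : ℂ) * (√(f x) : ℂ) = (f x : ℂ)
    rw [← Complex.ofReal_mul, Real.mul_self_sqrt (hf₀ x)]

variable [T2Space X] [LocallyCompactSpace X]

theorem exists_sum_mul_self_eq_one [Fintype ι] {U : ι → Set X} (hU : ∀ i, IsOpen (U i))
    {K : Set X} (hK : IsCompact K) (hKU : K ⊆ ⋃ i, U i) :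
    ∃ h : ι → C₀(X, ℂ), (∀ i, IsSelfAdjoint (h i)) ∧ (∀ i, Function.support (h i) ⊆ U i) ∧
      (∀ x, ∃ r ∈ Set.Icc (0 : ℝ) 1, (∑ i, h i * h i) x = (r : ℂ)) ∧
      ∀ x ∈ K, (∑ i, h i * h i) x = 1 := by
  obtain ⟨f, hfU, hf⟩ := PartitionOfUnity.exists_isSubordinate_of_locallyFinite_t2space hK U hU
    (locallyFinite_of_finite U) hKU
  choose h hsa hh using fun i => exists_isSelfAdjoint_mul_self_eq (hf i) (f.nonneg i)
  have sum_apply (x : X) : (∑ i, h i * h i) x = ((∑ᶠ i, f i x : ℝ) : ℂ) := by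
    simp only [zeroAtInfty_sum_apply, ZeroAtInftyContinuousMap.mul_apply, hh,
      finsum_eq_sum_of_fintype, Complex.ofReal_sum]
  refine ⟨h, hsa, fun i x hx => hfU i (subset_tsupport _ fun hfx => hx ?_),
    fun x => ⟨_, ⟨f.sum_nonneg x, f.sum_le_one x⟩, sum_apply x⟩, fun x hx => ?_⟩
  · simpa [hfx] using hh i x
  · rw [sum_apply, f.sum_eq_one hx, Complex.ofReal_one]

end ZeroAtInfty

section FreeAction

variable {Γ X Y : Type*} [Group Γ] [TopologicalSpace X] [MulAction Γ X] [TopologicalSpace Y]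
  [MulAction Γ Y]

theorem ProperFactorMap.exists_isCompact_norm_lt (π : ProperFactorMap Γ Y X) (f : C₀(Y, ℂ)) {ε : ℝ}
    (hε : 0 < ε) : ∃ K : Set X, IsCompact K ∧ ∀ y, π.toFun y ∉ K → ‖f y‖ < ε := by
  obtain ⟨L, hL, hLf⟩ := mem_cocompact.1 (Metric.tendsto_nhds.1 (zero_at_infty f) ε hε)
  refine ⟨π.toFun '' L, hL.image π.isFactorMap.isQuotientMap.continuous, fun y hy => ?_⟩
  rw [← dist_zero_right]
  exact hLf fun h => hy ⟨y, h, rfl⟩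

variable [T2Space X] [ContinuousConstSMul Γ X]

theorem exists_wandering_nhds (hα : ∀ (s : Γ) (x : X), s • x = x → s = 1) (F : Finset Γ) (x : X) :
    ∃ U ∈ 𝓝 x, ∀ s ∈ F, s ≠ 1 → ∀ z ∈ U, s⁻¹ • z ∉ U := by
  have exists_nhds (s : Γ) : ∃ U ∈ 𝓝 x, s ≠ 1 → ∀ z ∈ U, s⁻¹ • z ∉ U := by
    by_cases hs : s = 1
    · exact ⟨Set.univ, univ_mem, fun h => absurd hs h⟩
    have hne : x ≠ s⁻¹ • x := fun h => hs (inv_eq_one.1 (hα s⁻¹ x h.symm))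
    obtain ⟨V, hV, W, hW, hVW⟩ := Filter.disjoint_iff.1 (disjoint_nhds_nhds.2 hne)
    exact ⟨V ∩ (s⁻¹ • ·) ⁻¹' W, inter_mem hV ((continuous_const_smul s⁻¹).continuousAt hW),
      fun _ _ hz hz' => Set.disjoint_left.1 hVW hz'.1 hz.2⟩
  choose U hU hUs using exists_nhds
  refine ⟨⋂ s ∈ F, U s, (biInter_finset_mem F).2 fun s _ => hU s, fun s hs hs1 z hz hz' => ?_⟩
  exact hUs s hs1 z (Set.mem_iInter₂.1 hz s hs) (Set.mem_iInter₂.1 hz' s hs)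

theorem exists_isWandering [LocallyCompactSpace X] (hα : ∀ (s : Γ) (x : X), s • x = x → s = 1)
    (F : Finset Γ) {K : Set X} (hK : IsCompact K) :
    ∃ (n : ℕ) (p : Fin n → C₀(X, ℂ)), IsWandering (functionActionHom Γ X) F p ∧
      (∀ x, ‖(∑ i, p i * p i) x - 1‖ ≤ 1) ∧ ∀ x ∈ K, (∑ i, p i * p i) x = 1 := by
  choose U hU hUF using exists_wandering_nhds hα F
  obtain ⟨t, -, ht⟩ := hK.elim_nhds_subcover (fun x => interior (U x))
    fun x _ => interior_mem_nhds.2 (hU x)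
  let V (i : Fin t.card) : Set X := U (t.equivFin.symm i)
  have subset_iUnion : K ⊆ ⋃ i, interior (V i) := fun x hx => by
    obtain ⟨z, hz, hxz⟩ := Set.mem_iUnion₂.1 (ht hx)
    exact Set.mem_iUnion.2 ⟨t.equivFin ⟨z, hz⟩, by simpa [V] using hxz⟩
  obtain ⟨p, hsa, hpV, hsum, hpK⟩ :=
    exists_sum_mul_self_eq_one (fun i => isOpen_interior (s := V i)) hK subset_iUnion
  refine ⟨t.card, p, ⟨hsa, ?_, fun i s hs hs1 => ?_⟩, fun x => ?_, hpK⟩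
  · refine norm_zeroAtInfty_le zero_le_one fun x => ?_
    obtain ⟨r, ⟨hr₀, hr₁⟩, hr⟩ := hsum x
    rwa [hr, Complex.norm_of_nonneg hr₀]
  · ext x
    by_contra hne
    exact hUF _ s hs hs1 x (interior_subset (hpV i (left_ne_zero_of_mul hne)))
      (interior_subset (hpV i (right_ne_zero_of_mul hne)))
  · obtain ⟨r, ⟨hr₀, hr₁⟩, hr⟩ := hsum x
    rw [hr, ← Complex.ofReal_one, ← Complex.ofReal_sub, Complex.norm_real, Real.norm_eq_abs, abs_le]
    constructor <;> linarith

theorem IsWandering.map {A B : Type*} [NonUnitalCStarAlgebra A] [NonUnitalCStarAlgebra B]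
    {α : Γ →* (A →⋆ₙₐ[ℂ] A)} {β : Γ →* (B →⋆ₙₐ[ℂ] B)} {F : Finset Γ} {n : ℕ} {p : Fin n → A}
    (hp : IsWandering α F p) (θ : A →⋆ₙₐ[ℂ] B) (hθ : ∀ s a, θ (α s a) = β s (θ a)) :
    IsWandering β F fun i => θ (p i) where
  isSelfAdjoint i := (hp.isSelfAdjoint i).map θ
  norm_sum_le := by
    simp only [← map_mul, ← map_sum]
    exact (NonUnitalStarAlgHom.norm_apply_le θ _).trans hp.norm_sum_le
  mul_eq_zero i s hs hs1 := by
    rw [← hθ, ← map_mul, hp.mul_eq_zero i s hs hs1, map_zero]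

variable (π : ProperFactorMap Γ Y X)

/-- The C*-subalgebra `C₀(X) ⊆ C₀(Y)` of a proper factor map. -/
abbrev ProperFactorMap.algebra : CStarSubalgebra C₀(Y, ℂ) :=
  functionAlgebra π.toCocompactMap π.isFactorMap.isQuotientMap.surjective

theorem ProperFactorMap.isFreelyLocalizing_algebra [LocallyCompactSpace X]
    [ContinuousConstSMul Γ Y] (hα : ∀ (s : Γ) (x : X), s • x = x → s = 1) :
    IsFreelyLocalizing (functionActionHom Γ Y) π.algebra where
  commute p _ a := mul_comm p a
  exists_isWandering F f ε hε := by
    obtain ⟨K, hK, hKf⟩ := π.exists_isCompact_norm_lt f hε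
    obtain ⟨n, p, hp, hp_le, hpK⟩ := exists_isWandering hα F hK
    have pullback_action (s : Γ) (h : C₀(X, ℂ)) :
        pullback π.toCocompactMap (functionActionHom Γ X s h) =
          functionActionHom Γ Y s (pullback π.toCocompactMap h) := by
      ext y
      exact congrArg h (π.isFactorMap.map_smul s⁻¹ y).symm
    refine ⟨n, _, hp.map (pullback π.toCocompactMap) pullback_action, fun i => ⟨p i, rfl⟩,
      norm_zeroAtInfty_le hε.le fun y => ?_⟩
    simp only [← map_mul, ← map_sum]
    change ‖f y * (∑ i, p i * p i) (π.toFun y) - f y‖ ≤ ε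
    rw [← mul_sub_one, norm_mul]
    by_cases hy : π.toFun y ∈ K
    · rw [hpK _ hy, sub_self, norm_zero, mul_zero]
      exact hε.le
    · exact (mul_le_of_le_one_right (norm_nonneg _) (hp_le _)).trans (hKf y hy).le

end FreeAction

end

end CrossedExt

theorem theorem2p3_general {Γ X Y : Type*} [Group Γ] (hΓ : HasAP Γ)
    [TopologicalSpace X] [T2Space X] [LocallyCompactSpace X] [TopologicalSpace Y]
    [MulAction Γ X] [ContinuousConstSMul Γ X] [MulAction Γ Y] [ContinuousConstSMul Γ Y]
    (hα : ∀ (s : Γ) (x : X), s • x = x → s = 1) (π : ProperFactorMap Γ Y X) :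
    ∃ Φ : ExtensionClass π ≃o
        Set.Icc (factorCrossedProduct Γ π.toCocompactMap)
          (factorCrossedProduct Γ (CocompactMap.id Y)),
      (∀ Z : IntermediateExtension π,
        (Φ (Quotient.mk _ Z)).1 = factorCrossedProduct Γ Z.toCocompactMap) ∧
      (∀ a b, Φ (a ⊔ b) = Φ a ⊔ Φ b) ∧ ∀ a b, Φ (a ⊓ b) = Φ a ⊓ Φ b := by
  rw [factorCrossedProduct_eq π.toCocompactMap π.isFactorMap.isQuotientMap.surjective
      π.isFactorMap.map_smul,
    factorCrossedProduct_eq (CocompactMap.id Y) Function.surjective_id fun _ _ => rfl]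
  let G : ExtensionClass π ≃o invariantExtensions (functionActionHom Γ Y) π.algebra :=
    { ExtensionClass.gelfand π with map_rel_iff' := Iff.rfl }
  let Φ := G.trans (crossedProductOrderIso
    (E := functionAlgebra (CocompactMap.id Y) Function.surjective_id) hΓ
    multiplicationRep_injective (π.isFreelyLocalizing_algebra hα) fun a => ⟨a, rfl⟩)
  refine ⟨Φ, fun Z => ?_, OrderIso.map_sup Φ, OrderIso.map_inf Φ⟩
  exact (factorCrossedProduct_eq Z.toCocompactMap Z.isFactorMap_p.isQuotientMap.surjective
    Z.isFactorMap_p.map_smul).symm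

theorem theorem2p3 {Γ X Y : Type*} [Group Γ] (hΓ : HasAP Γ)
    [TopologicalSpace X] [T2Space X] [LocallyCompactSpace X]
    [TopologicalSpace Y] [T2Space Y] [LocallyCompactSpace Y]
    [MulAction Γ X] [ContinuousConstSMul Γ X] [MulAction Γ Y] [ContinuousConstSMul Γ Y]
    (hα : ∀ (s : Γ) (x : X), s • x = x → s = 1) (hβ : ∀ (s : Γ) (y : Y), s • y = y → s = 1)
    (π : ProperFactorMap Γ Y X) :
    ∃ Φ : ExtensionClass π ≃o
        Set.Icc (factorCrossedProduct Γ π.toCocompactMap)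
          (factorCrossedProduct Γ (CocompactMap.id Y)),
      (∀ Z : IntermediateExtension π,
        (Φ (Quotient.mk _ Z)).1 = factorCrossedProduct Γ Z.toCocompactMap) ∧
      (∀ a b, Φ (a ⊔ b) = Φ a ⊔ Φ b) ∧ ∀ a b, Φ (a ⊓ b) = Φ a ⊓ Φ b :=
  theorem2p3_general hΓ hα π
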